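/- Let $\Omega\subseteq\mathbb H^n\cong\mathbb R^{4n}$ be open, with coordinates $q_l=x_{4l}+\mathbf i x_{4l+1}+\mathbf j x_{4l+2}+\mathbf k x_{4l+3}$, $0\le l\le n-1$, and fix a basis $\omega^0,\dots,\omega^{2n-1}$ of $\mathbb C^{2n}$. *Operators.* Let $\nabla_{(2l)0}=\partial_{x_{4l}}+i\partial_{x_{4l+1}}$, $\nabla_{(2l)1}=-\partial_{x_{4l+2}}-i\partial_{x_{4l+3}}$, $\nabla_{(2l+1)0}=\partial_{x_{4l+2}}-i\partial_{x_{4l+3}}$, $\nabla_{(2l+1)1}=\partial_{x_{4l}}-i\partial_{x_{4l+1}}$. On test $p$-forms $F=\sum_I f_I\omega^I\in\mathcal D^p(\Omega)=C_0^\infty(\Omega,\wedge^p\mathbb C^{2n})$ put $d_\alpha F=\sum_{k,I}\nabla_{k\alpha}f_I\,\omega^k\wedge\omega^I$ ($\alpha=0,1$) and $\triangle F=d_0d_1F$. *Currents.* A $p$-current ($0\le p\le 2n$) is a continuous $\mathbb C$-linear functional on $\mathcal D^{2n-p}(\Omega)$; put $(d_\alpha F)(\eta)=-F(d_\alpha\eta)$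 and $(\triangle F)(\eta)=F(\triangle\eta)$ (currents of degree larger than $2n$ are zero). $F$ is closed if $d_0F=d_1F=0$. A $2k$-current $F$ is positive if $F(\eta)\ge0$ for every $\eta\in\mathcal D^{2n-2k}(\Omega)$ all of whose values are strongly positive, i.e. finite sums with non-negative coefficients of elements $\eta_1^*\tilde\omega^0\wedge\eta_1^*\tilde\omega^1\wedge\dots\wedge\eta_r^*\tilde\omega^0\wedge\eta_r^*\tilde\omega^1$, $r=n-k$, where $\eta_1,\dots,\eta_r:\mathbb H^n\to\mathbb H$ are linearly independent right $\mathbb H$-linear maps. Here, for $\eta(q)=\sum_l g_lq_l$, $\eta^*\tilde\omega^p=\sum_{l}\bigl(\tau(g_l)_{p0}\,\omega^{2l}+\tau(g_l)_{p1}\,\omega^{2l+1}\bigr)$, $p=0,1$, with $\tau(a_0+\mathbf i a_1+\mathbf j a_2+\mathbf k a_3)=\begin{pmatrix}a_0-ia_1&-a_2+ia_3\\a_2+ia_3&a_0+ia_1\end{pmatrix}$. *Products.* If $T=\sum_I T_I\omega^I$ is a current whose coefficients $T_I$ are complex Radon measures on $\Omega$ and $u$ is a locally bounded Borel function on $\Omega$,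 then $uT:=\sum_I uT_I\,\omega^I$. A function $u:\Omega\to[-\infty,\infty)$ is plurisubharmonic (PSH) if it is upper semicontinuous and its restriction to each right quaternionic line $\{a+v\xi:\xi\in\mathbb H\}$, $v\ne0$, is subharmonic. **Proposition.** Let $0\le k\le n$ and let $T$ be a closed positive $2k$-current on $\Omega$. 1. For every locally bounded PSH function $u$ on $\Omega$ the current $uT$ is well defined ($T$ has measure coefficients, and $uT$ is uniquely determined), and $$\triangle u\wedge T:=\triangle(uT)$$ is a closed positive $(2k+2)$-current. 2. For every $p\ge0$ and all locally bounded PSH functions $u_1,\dots,u_p$ on $\Omega$, the current defined inductively by $$\triangle u_1\wedge\dots\wedge\triangle u_p\wedge T:=\triangle\bigl(u_1\,\triangle u_2\wedge\dots\wedge\triangle u_p\wedge T\bigr)$$ is a closed positive $(2k+2p)$-current. -/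

import Mathlib

open scoped Distributions

noncomputable section

/-- The quaternions carry their Borel σ-algebra (so `volume` is Lebesgue measure on `ℍ ≅ ℝ⁴`). -/
instance : MeasurableSpace (Quaternion ℝ) := borel _

instance : BorelSpace (Quaternion ℝ) := ⟨rfl⟩

namespace QuatPluripotential

/-- The flat quaternionic space `ℍⁿ ≅ ℝ⁴ⁿ`, with coordinates
`q_l = x_{4l} + i x_{4l+1} + j x_{4l+2} + k x_{4l+3}`, `l = 0, …, n-1`. -/
abbrev Hn (n : ℕ) : Type := Fin n → Quaternion ℝ

/-! ### The exterior algebra of `ℂ²ⁿ` -/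

/-- Increasing multi-indices of length `p` in `{0, …, 2n-1}`, as subsets with `p` elements. -/
abbrev MultiIndex (n p : ℕ) : Type := {I : Finset (Fin (2 * n)) // I.card = p}

/-- `∧ᵖ ℂ²ⁿ`, in the basis `ω^I` (`I` increasing of length `p`): the element `∑_I f_I ω^I` is
the family `(f_I)_I` of its coefficients. -/
abbrev Ext (n p : ℕ) : Type := MultiIndex n p → ℂ

/-- The number `l` with `j ∈ {2l, 2l+1}`. -/
def quatIndex {n : ℕ} (j : Fin (2 * n)) : Fin n := ⟨j.1 / 2, by omega⟩

/-- The parity of `j`. -/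
def parity {n : ℕ} (j : Fin (2 * n)) : Fin 2 := ⟨j.1 % 2, by omega⟩

/-- The exterior product `F ↦ ω^k ∧ F` from `∧ᵖ ℂ²ⁿ` to `∧^{p'} ℂ²ⁿ`, `p' = p + 1`, that is
`ω^k ∧ ω^I = (-1)^{#{j ∈ I : j < k}} ω^{I ∪ {k}}` for `k ∉ I`, and `0` for `k ∈ I`.
(For `p' ≠ p + 1` this is the zero map.) -/
def leftWedge {n : ℕ} (p p' : ℕ) (k : Fin (2 * n)) : Ext n p →L[ℂ] Ext n p' :=
  ContinuousLinearMap.pi fun J : MultiIndex n p' =>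
    if h : k ∈ J.1 ∧ (J.1.erase k).card = p then
      ((-1 : ℂ) ^ (J.1.filter (· < k)).card) •
        (ContinuousLinearMap.proj (R := ℂ) (φ := fun _ : MultiIndex n p => ℂ)
          ⟨J.1.erase k, h.2⟩)
    else 0

/-- The exterior product `a_0 ∧ ⋯ ∧ a_{p-1}` of vectors `a_i = ∑_j (a_i)_j ω^j` of `ℂ²ⁿ`; its
coefficients are the maximal minors of `(a_i)_j`. -/
def wedgeVectors {n p : ℕ} (a : Fin p → Fin (2 * n) → ℂ) : Ext n p :=
  fun I => Matrix.det (Matrix.of fun i j : Fin p => a i (I.1.orderEmbOfFin I.2 j))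

/-! ### Strongly positive elements -/

/-- The conjugate embedding `τ : ℍ → ℂ^{2×2}`. -/
def tau (q : Quaternion ℝ) : Matrix (Fin 2) (Fin 2) ℂ :=
  !![(q.re : ℂ) - Complex.I * q.imI, -(q.imJ : ℂ) + Complex.I * q.imK;
     (q.imJ : ℂ) + Complex.I * q.imK, (q.re : ℂ) + Complex.I * q.imI]

/-- The complex `2l × 2m` matrix `τ(A)` of a quaternionic `l × m` matrix `A`. -/
def tauMatrix {l m : ℕ} (A : Matrix (Fin l) (Fin m) (Quaternion ℝ)) :
    Matrix (Fin (2 * l)) (Fin (2 * m)) ℂ :=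
  Matrix.of fun i j => tau (A (quatIndex i) (quatIndex j)) (parity i) (parity j)

/-- Elementary strongly positive elements of `∧^{2r} ℂ²ⁿ` (`p = 2r`):
`η₁^*ω̃⁰ ∧ η₁^*ω̃¹ ∧ ⋯ ∧ η_r^*ω̃⁰ ∧ η_r^*ω̃¹` with linearly independent right `ℍ`-linear maps
`η_j : ℍⁿ → ℍ`. The map `η_j(q) = ∑_l g_{jl} q_l` is given by the `j`-th row of `g`; such maps
form a left `ℍ`-vector space, and the pull-backs `η_j^*ω̃⁰`, `η_j^*ω̃¹` are the rows
`2j`, `2j+1` of `τ(g)`. -/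
def IsElementaryStronglyPositive {n p : ℕ} (ω : Ext n p) : Prop :=
  ∃ (r : ℕ) (hr : p = 2 * r) (g : Matrix (Fin r) (Fin n) (Quaternion ℝ)),
    LinearIndependent (Quaternion ℝ) (fun j : Fin r => (g j : Fin n → Quaternion ℝ)) ∧
      ω = wedgeVectors (fun i : Fin p => tauMatrix g (Fin.cast hr i))

/-- The convex cone of strongly positive elements. -/
def IsStronglyPositive {n p : ℕ} (ω : Ext n p) : Prop :=
  ∃ (m : ℕ) (c : Fin m → ℝ) (ξ : Fin m → Ext n p),
    (∀ l, 0 ≤ c l) ∧ (∀ l, IsElementaryStronglyPositive (ξ l)) ∧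
      ω = ∑ l, (c l : ℂ) • ξ l

/-! ### Test forms and the operators `d₀`, `d₁`, `△` -/

variable {n : ℕ} {Ω : TopologicalSpace.Opens (Hn n)}

/-- Test `p`-forms: smooth compactly supported maps from `Ω` to `∧ᵖ ℂ²ⁿ`. -/
abbrev TestForm (Ω : TopologicalSpace.Opens (Hn n)) (p : ℕ) : Type := 𝓓(Ω, Ext n p)

/-- The derivative `∂_v` of test forms in the direction of `v` in the `l`-th quaternionic variable;
for `v = 1, i, j, k` it is `∂_{x_{4l}}, ∂_{x_{4l+1}}, ∂_{x_{4l+2}}, ∂_{x_{4l+3}}`. -/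
def partialQ {p : ℕ} (l : Fin n) (v : Quaternion ℝ) : TestForm Ω p →L[ℂ] TestForm Ω p :=
  TestFunction.lineDerivCLM ℂ (Pi.single l v : Hn n)

/-- Multiplication of test forms by the imaginary unit. -/
def mulI {p : ℕ} : TestForm Ω p →L[ℂ] TestForm Ω p :=
  TestFunction.postcompCLM (Complex.I • ContinuousLinearMap.id ℂ (Ext n p))

/-- The operators `∇_{jα}` applied to the coefficients of test forms:
`∇_{(2l)0} = ∂_{x_{4l}} + i ∂_{x_{4l+1}}`, `∇_{(2l)1} = -∂_{x_{4l+2}} - i ∂_{x_{4l+3}}`,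
`∇_{(2l+1)0} = ∂_{x_{4l+2}} - i ∂_{x_{4l+3}}`, `∇_{(2l+1)1} = ∂_{x_{4l}} - i ∂_{x_{4l+1}}`. -/
def nabla {p : ℕ} (j : Fin (2 * n)) (α : Fin 2) : TestForm Ω p →L[ℂ] TestForm Ω p :=
  let l := quatIndex j
  !![partialQ l ⟨1, 0, 0, 0⟩ + mulI ∘L partialQ l ⟨0, 1, 0, 0⟩,
      -partialQ l ⟨0, 0, 1, 0⟩ - mulI ∘L partialQ l ⟨0, 0, 0, 1⟩;
     partialQ l ⟨0, 0, 1, 0⟩ - mulI ∘L partialQ l ⟨0, 0, 0, 1⟩,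
      partialQ l ⟨1, 0, 0, 0⟩ - mulI ∘L partialQ l ⟨0, 1, 0, 0⟩] (parity j) α

/-- `d_α F = ∑_{k, I} ∇_{kα} f_I ω^k ∧ ω^I`, from test `p`-forms to test `p'`-forms, `p' = p + 1`
(the zero map for `p' ≠ p + 1`). -/
def dForm (p p' : ℕ) (α : Fin 2) : TestForm Ω p →L[ℂ] TestForm Ω p' :=
  ∑ k : Fin (2 * n), TestFunction.postcompCLM (leftWedge p p' k) ∘L nabla k α

/-! ### Currents -/

/-- The `p`-currents on `Ω` (`p ≤ 2n`): the topological dual of the space of test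
`(2n-p)`-forms. -/
abbrev Current (Ω : TopologicalSpace.Opens (Hn n)) (p : ℕ) : Type :=
  TestForm Ω (2 * n - p) →L[ℂ] ℂ

namespace Current

variable {p : ℕ}

/-- `(d_α F)(η) = -F(d_α η)` for test `(2n-p-1)`-forms `η` (so `d_α F = 0` for `p = 2n`). -/
def d (α : Fin 2) (F : Current Ω p) : Current Ω (p + 1) :=
  -(F ∘L dForm (2 * n - (p + 1)) (2 * n - p) α)

/-- `(△F)(η) = F(△η)`, `△η = d₀ d₁ η`, for test `(2n-p-2)`-forms `η` (so `△F = 0` for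
`p > 2n - 2`). -/
def laplace (F : Current Ω p) : Current Ω (p + 2) :=
  F ∘L dForm (2 * n - (p + 1)) (2 * n - p) 0 ∘L dForm (2 * n - (p + 2)) (2 * n - (p + 1)) 1

/-- A current is closed if `d₀ F = d₁ F = 0`. -/
def IsClosed (F : Current Ω p) : Prop := ∀ α : Fin 2, F.d α = 0

/-- A current is positive if it is real and nonnegative on strongly positive test forms. -/
def IsPositive (F : Current Ω p) : Prop :=
  ∀ η : TestForm Ω (2 * n - p), (∀ q ∈ Ω, IsStronglyPositive (η q)) →
    0 ≤ (F η).re ∧ (F η).im = 0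

/-- `T` has measure coefficients: its coefficient at the multi-index complementary to `J` is, up to
the sign `ε` of the complement, the complex Radon measure `h_J μ_J` on `Ω`, that is
`T(φ) = ∑_J ∫ φ_J h_J dμ_J`. -/
def IsRepresentedBy (T : Current Ω p) (μ : MultiIndex n (2 * n - p) → MeasureTheory.Measure (Hn n))
    (h : MultiIndex n (2 * n - p) → Hn n → ℂ) : Prop :=
  (∀ J, MeasureTheory.LocallyIntegrableOn (h J) (Ω : Set (Hn n)) (μ J)) ∧
    ∀ φ : TestForm Ω (2 * n - p), T φ = ∑ J, ∫ x, φ x J * h J x ∂(μ J)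

/-- `S = uT = ∑_I u T_I ω^I`: the coefficients `T_I` are measures, and those of `S` are the
measures `u T_I`. -/
def IsProduct (u : Hn n → ℝ) (T S : Current Ω p) : Prop :=
  ∃ (μ : MultiIndex n (2 * n - p) → MeasureTheory.Measure (Hn n))
    (h : MultiIndex n (2 * n - p) → Hn n → ℂ),
    T.IsRepresentedBy μ h ∧ S.IsRepresentedBy μ (fun J x => (u x : ℂ) * h J x)

open scoped Classical in
/-- The current `uT` (it is `0` if there is no such product). -/
def mul (u : Hn n → ℝ) (T : Current Ω p) : Current Ω p :=
  if h : ∃ S, IsProduct u T S then h.choose else 0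

/-- `△u ∧ T := △(uT)` for a function `u` with values in `[-∞, ∞)` that is finite on `Ω`. -/
def laplaceWedge (u : Hn n → EReal) (T : Current Ω p) : Current Ω (p + 2) :=
  (mul (fun x => (u x).toReal) T).laplace

/-- `△u₁ ∧ ⋯ ∧ △u_m ∧ T := △(u₁ △u₂ ∧ ⋯ ∧ △u_m ∧ T)`, inductively. -/
def laplaceWedges (T : Current Ω p) : (m : ℕ) → (Fin m → Hn n → EReal) → Current Ω (p + 2 * m)
  | 0, _ => T
  | m + 1, u => laplaceWedge (u 0) (laplaceWedges T m (Fin.tail u))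

end Current

/-! ### Plurisubharmonic functions -/

/-- Subharmonicity of `f : U → [-∞, ∞)` on an open set `U ⊆ ℍ ≅ ℝ⁴`: `f` is upper semicontinuous
and `f(c)` is at most the mean of `f` over any closed ball `B ⊆ U` with centre `c`. Here the
inequality `|B| f(c) ≤ ∫_B f` is written for the nonnegative functions `M - f`, with `M` a real
upper bound of `f` on `B`, so that it makes sense for `f` that take the value `-∞`. -/
def IsSubharmonicOn (f : Quaternion ℝ → EReal) (U : Set (Quaternion ℝ)) : Prop :=
  UpperSemicontinuousOn f U ∧ (∀ ξ ∈ U, f ξ < ⊤) ∧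
    ∀ (c : Quaternion ℝ) (r : ℝ), 0 < r → Metric.closedBall c r ⊆ U →
      ∀ M : ℝ, (∀ ξ ∈ Metric.closedBall c r, f ξ ≤ M) →
        ∫⁻ ξ in Metric.closedBall c r, ((M : EReal) - f ξ).toENNReal ≤
          MeasureTheory.volume (Metric.closedBall c r) * ((M : EReal) - f c).toENNReal

/-- Plurisubharmonic functions `u : Ω → [-∞, ∞)`: upper semicontinuous, and subharmonic on each
right quaternionic line `{a + vξ : ξ ∈ ℍ}`. -/
def IsPSH (Ω : TopologicalSpace.Opens (Hn n)) (u : Hn n → EReal) : Prop :=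
  UpperSemicontinuousOn u (Ω : Set (Hn n)) ∧ (∀ q ∈ Ω, u q < ⊤) ∧
    ∀ a v : Hn n, v ≠ 0 →
      IsSubharmonicOn (fun ξ => u (fun l => a l + v l * ξ)) {ξ | (fun l => a l + v l * ξ) ∈ Ω}

/-- Local boundedness on `Ω` (in particular finiteness at every point of `Ω`). -/
def IsLocallyBounded (Ω : TopologicalSpace.Opens (Hn n)) (u : Hn n → EReal) : Prop :=
  ∀ a ∈ Ω, ∃ M : ℝ, ∀ᶠ x in nhds a, ((-M : ℝ) : EReal) ≤ u x ∧ u x ≤ (M : EReal)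

end QuatPluripotential

end

/-!
Strongly positive elements span the even-degree forms, so by Riesz a positive current has measure
coefficients and `uT` makes sense. A locally bounded plurisubharmonic `u` is the bounded pointwise
limit of smooth functions `v_i`: mollify `u` with a weight radial in each quaternionic variable, so
that the submean value property on right quaternionic lines gives convergence and makes the Hessian
of `v_i` have nonnegative trace along every such line. Averaging the real Hessian over right
multiplication by `1, i, j, k` multiplies the quaternionic Hessian by `4` and turns it into a sum of
squares, so `△v_i ∧ η` is strongly positive whenever `η` is. Integration by parts against the closed
current `T` gives `(v_i T)(△η) = T(△v_i ∧ η) ≥ 0`, and dominated convergence passes to `u`.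
-/

noncomputable section

namespace QuatPluripotential

open scoped ContDiff ENNReal CompactlySupported
open MeasureTheory Filter

variable {n : ℕ} {Ω : TopologicalSpace.Opens (Hn n)}

/-! ### Constant complex vector fields -/

section ComplexDeriv

variable {E F G : Type*} [NormedAddCommGroup E] [NormedSpace ℝ E]
  [NormedAddCommGroup F] [NormedSpace ℝ F] [NormedSpace ℂ F]
  [NormedAddCommGroup G] [NormedSpace ℝ G] [NormedSpace ℂ G]

/-- The derivative of a vector-valued function along the constant complex vector field
`z.1 + i z.2`. -/
def complexDeriv (z : E × E) (f : E → F) (x : E) : F :=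
  fderiv ℝ f x z.1 + Complex.I • fderiv ℝ f x z.2

lemma complexDeriv_sum {ι : Type*} (s : Finset ι) (z : E × E) {f : ι → E → F}
    (hf : ∀ i ∈ s, Differentiable ℝ (f i)) (x : E) :
    complexDeriv z (fun y => ∑ i ∈ s, f i y) x = ∑ i ∈ s, complexDeriv z (f i) x := by
  have h := fderiv_fun_sum (𝕜 := ℝ) (x := x) (u := s) (A := f) (fun i hi => hf i hi x)
  simp [complexDeriv, h, Finset.smul_sum, Finset.sum_add_distrib]

variable [IsScalarTower ℝ ℂ F]

lemma contDiff_complexDeriv (z : E × E) {f : E → F} (hf : ContDiff ℝ ∞ f) :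
    ContDiff ℝ ∞ (complexDeriv z f) := by
  have hf' (v : E) : ContDiff ℝ ∞ (fun x => fderiv ℝ f x v) :=
    (hf.fderiv_right (by simp)).clm_apply contDiff_const
  exact (hf' z.1).add (contDiff_const.smul (hf' z.2))

lemma complexDeriv_clm_comp [IsScalarTower ℝ ℂ G] (z : E × E) (A : F →L[ℂ] G) {f : E → F}
    (hf : Differentiable ℝ f) (x : E) :
    complexDeriv z (fun y => A (f y)) x = A (complexDeriv z f x) := by
  have h : HasFDerivAt (fun y => A (f y)) ((A.restrictScalars ℝ).comp (fderiv ℝ f x)) x :=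
    (A.restrictScalars ℝ).hasFDerivAt.comp x (hf x).hasFDerivAt
  simp [complexDeriv, h.fderiv]

lemma complexDeriv_smul (z : E × E) {v : E → ℂ} {f : E → F}
    (hv : Differentiable ℝ v) (hf : Differentiable ℝ f) (x : E) :
    complexDeriv z (fun y => v y • f y) x
      = v x • complexDeriv z f x + complexDeriv z v x • f x := by
  have h : fderiv ℝ (fun y => v y • f y) x = v x • fderiv ℝ f x + (fderiv ℝ v x).smulRight (f x) :=
    ((hv x).hasFDerivAt.smul (hf x).hasFDerivAt).fderiv
  simp only [complexDeriv, h, add_apply, smul_apply,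
    ContinuousLinearMap.smulRight_apply, smul_add, add_smul, smul_eq_mul, mul_smul,
    smul_comm (v x) Complex.I]
  abel

lemma complexDeriv_complexDeriv (z w : E × E) {f : E → F} (hf : ContDiff ℝ ∞ f) (x : E) :
    complexDeriv z (complexDeriv w f) x =
      (fderiv ℝ (fderiv ℝ f) x z.1 w.1 + Complex.I • fderiv ℝ (fderiv ℝ f) x z.1 w.2)
      + Complex.I • (fderiv ℝ (fderiv ℝ f) x z.2 w.1
        + Complex.I • fderiv ℝ (fderiv ℝ f) x z.2 w.2) := by
  have hf' : Differentiable ℝ (fderiv ℝ f) :=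
    (hf.fderiv_right (m := ∞) (by simp)).differentiable (by simp)
  have hf'' (v : E) : HasFDerivAt (fun y => fderiv ℝ f y v)
      ((fderiv ℝ (fderiv ℝ f) x).flip v) x := by
    simpa using (hf' x).hasFDerivAt.clm_apply (hasFDerivAt_const v x)
  have h : fderiv ℝ (complexDeriv w f) x = (fderiv ℝ (fderiv ℝ f) x).flip w.1
      + Complex.I • (fderiv ℝ (fderiv ℝ f) x).flip w.2 :=
    ((hf'' w.1).add ((hf'' w.2).const_smul Complex.I)).fderiv
  rw [complexDeriv, h]
  simp

lemma complexDeriv_comm (z w : E × E) {f : E → F} (hf : ContDiff ℝ ∞ f) (x : E) :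
    complexDeriv z (complexDeriv w f) x = complexDeriv w (complexDeriv z f) x := by
  have hs : IsSymmSndFDerivAt ℝ f x :=
    hf.contDiffAt.isSymmSndFDerivAt (by simpa using WithTop.coe_le_coe.2 (le_top (a := (2 : ℕ∞))))
  rw [complexDeriv_complexDeriv _ _ hf, complexDeriv_complexDeriv _ _ hf,
    hs.eq z.1 w.1, hs.eq z.1 w.2, hs.eq z.2 w.1, hs.eq z.2 w.2]
  simp only [smul_add]
  abel

end ComplexDeriv

/-! ### The operators `∇_{jα}` and `d_α` in terms of derivatives -/

/-- The real basis `1, i, j, k` of the quaternions. -/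
def quatBasis : Fin 4 → Quaternion ℝ :=
  ![⟨1, 0, 0, 0⟩, ⟨0, 1, 0, 0⟩, ⟨0, 0, 1, 0⟩, ⟨0, 0, 0, 1⟩]

/-- The real and imaginary parts of the constant complex vector field `∇_{jα}` on `ℍⁿ`. -/
def nablaDir (j : Fin (2 * n)) (α : Fin 2) : Hn n × Hn n :=
  Prod.map (Pi.single (quatIndex j)) (Pi.single (quatIndex j))
    (!![(quatBasis 0, quatBasis 1), (-quatBasis 2, -quatBasis 3);
        (quatBasis 2, -quatBasis 3), (quatBasis 0, -quatBasis 1)] (parity j) α)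

lemma partialQ_apply {p : ℕ} (l : Fin n) (v : Quaternion ℝ) (φ : TestForm Ω p) (x : Hn n) :
    partialQ l v φ x = fderiv ℝ φ x (Pi.single l v) := by
  rw [partialQ, TestFunction.lineDerivCLM_eq_fderivCLM, TestFunction.fderivCLM_apply_of_le]
  simp

lemma mulI_apply {p : ℕ} (φ : TestForm Ω p) (x : Hn n) :
    mulI φ x = Complex.I • φ x := by
  simp [mulI]

lemma nabla_apply {p : ℕ} (j : Fin (2 * n)) (α : Fin 2) (φ : TestForm Ω p) (x : Hn n) :
    nabla j α φ x = complexDeriv (nablaDir j α) φ x := by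
  let l := quatIndex j
  have hnabla : nabla (Ω := Ω) (p := p) j α =
      !![partialQ l (quatBasis 0) + mulI ∘L partialQ l (quatBasis 1),
          -partialQ l (quatBasis 2) - mulI ∘L partialQ l (quatBasis 3);
         partialQ l (quatBasis 2) - mulI ∘L partialQ l (quatBasis 3),
          partialQ l (quatBasis 0) - mulI ∘L partialQ l (quatBasis 1)] (parity j) α := rfl
  rw [hnabla, complexDeriv, nablaDir]
  generalize parity j = β
  fin_cases β <;> fin_cases α <;>
    simp [l, partialQ_apply, mulI_apply, Pi.single_neg, sub_eq_add_neg]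

/-- The operator `d_α` on functions with values in the exterior algebra. -/
def dFun (p p' : ℕ) (α : Fin 2) (f : Hn n → Ext n p) (x : Hn n) : Ext n p' :=
  ∑ k, leftWedge p p' k (complexDeriv (nablaDir k α) f x)

lemma coe_dForm (p p' : ℕ) (α : Fin 2) (φ : TestForm Ω p) :
    (dForm p p' α φ : Hn n → Ext n p') = dFun p p' α φ := by
  ext1 x
  simp [dForm, dFun, nabla_apply]

/-! ### Exterior multiplication -/

section LinearOrder

variable {ι : Type*} [LinearOrder ι] {J : Finset ι} {m : ℕ}

lemma card_filter_lt_orderEmbOfFin (h : J.card = m) (i : Fin m) :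
    (J.filter (· < J.orderEmbOfFin h i)).card = i := by
  have hfilter : J.filter (· < J.orderEmbOfFin h i)
      = (Finset.Iio i).map (J.orderEmbOfFin h).toEmbedding := by
    conv_lhs => enter [2]; rw [← Finset.map_orderEmbOfFin_univ J h]
    rw [Finset.filter_map]
    congr 1
    ext j
    simp
  rw [hfilter, Finset.card_map, Fin.card_Iio]

lemma orderEmbOfFin_erase (h : J.card = m + 1) (i : Fin (m + 1))
    (h' : (J.erase (J.orderEmbOfFin h i)).card = m) (j : Fin m) :
    (J.erase (J.orderEmbOfFin h i)).orderEmbOfFin h' j = J.orderEmbOfFin h (i.succAbove j) := by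
  have := Finset.orderEmbOfFin_unique h' (f := fun j => J.orderEmbOfFin h (i.succAbove j))
    (fun x => by simp [Fin.succAbove_ne])
    (fun a b hab => (J.orderEmbOfFin h).strictMono (Fin.strictMono_succAbove i hab))
  exact (congrFun this j).symm

end LinearOrder

section Exterior

variable {p p' p'' : ℕ}

/-- The coefficient of `ω^I` in `F`, for an arbitrary set `I` of indices; it is `0` if `I` does not
have `p` elements. -/
def coeff (F : Ext n p) (I : Finset (Fin (2 * n))) : ℂ :=
  if h : I.card = p then F ⟨I, h⟩ else 0

lemma leftWedge_apply (k : Fin (2 * n)) (F : Ext n p) (J : MultiIndex n p') :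
    leftWedge p p' k F J =
      if k ∈ J.1 then (-1) ^ (J.1.filter (· < k)).card * coeff F (J.1.erase k) else 0 := by
  unfold leftWedge coeff
  by_cases h : k ∈ J.1 <;> by_cases h' : (J.1.erase k).card = p <;>
    simp [h, h', -Finset.card_erase_of_mem]

lemma leftWedge_eq_zero (h : p' ≠ p + 1) (k : Fin (2 * n)) : leftWedge p p' k = 0 := by
  ext F J
  rw [leftWedge_apply, zero_apply, Pi.zero_apply]
  refine ite_eq_right_iff.2 fun hk => ?_
  have hcard : (J.1.erase k).card ≠ p := fun hp =>
    h <| by rw [← J.2, ← Finset.card_erase_add_one hk, hp]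
  rw [coeff, dif_neg hcard, mul_zero]

lemma coeff_leftWedge (k : Fin (2 * n)) (F : Ext n p) (J : Finset (Fin (2 * n))) :
    coeff (leftWedge p p' k F) J = if J.card = p' then
      if k ∈ J then (-1) ^ (J.filter (· < k)).card * coeff F (J.erase k) else 0 else 0 := by
  by_cases h : J.card = p' <;> simp [coeff, h, leftWedge_apply]

lemma leftWedge_anticomm_of_lt {j k : Fin (2 * n)} (hjk : j < k) (F : Ext n p) :
    leftWedge p' p'' j (leftWedge p p' k F) = - leftWedge p' p'' k (leftWedge p p' j F) := by
  ext J
  simp only [leftWedge_apply, Pi.neg_apply, coeff_leftWedge]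
  by_cases hj : j ∈ J.1; swap
  · simp [hj]
  by_cases hk : k ∈ J.1; swap
  · simp [hk]
  have hcard : (J.1.erase j).card = (J.1.erase k).card := by
    rw [Finset.card_erase_of_mem hj, Finset.card_erase_of_mem hk]
  have hfilter_j : (J.1.erase k).filter (· < j) = J.1.filter (· < j) := by
    ext i; simp only [Finset.mem_filter, Finset.mem_erase]; grind
  have hfilter_k : (J.1.filter (· < k)).card = ((J.1.erase j).filter (· < k)).card + 1 := by
    rw [Finset.filter_erase, Finset.card_erase_add_one (by simp [hj, hjk])]
  simp only [Finset.mem_erase, hj, hk, hjk.ne, hjk.ne', ne_eq, not_false_eq_true, and_self, if_true,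
    hcard, hfilter_j, hfilter_k, Finset.erase_right_comm (a := k) (b := j)]
  split_ifs <;> ring

lemma leftWedge_anticomm (j k : Fin (2 * n)) (F : Ext n p) :
    leftWedge p' p'' j (leftWedge p p' k F) = - leftWedge p' p'' k (leftWedge p p' j F) := by
  rcases lt_trichotomy j k with h | rfl | h
  · exact leftWedge_anticomm_of_lt h F
  · ext J
    simp [leftWedge_apply, coeff_leftWedge]
  · rw [leftWedge_anticomm_of_lt h F, neg_neg]

/-- The exterior product `(a, F) ↦ (∑_k a_k ω^k) ∧ F`. As for `leftWedge`, it vanishes unless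
`p' = p + 1`. -/
def vecWedge (p p' : ℕ) : (Fin (2 * n) → ℂ) →ₗ[ℂ] Ext n p →ₗ[ℂ] Ext n p' :=
  Fintype.linearCombination ℂ fun k => (leftWedge p p' k).toLinearMap

lemma vecWedge_apply (a : Fin (2 * n) → ℂ) (F : Ext n p) :
    vecWedge p p' a F = ∑ k, a k • leftWedge p p' k F := by
  simp [vecWedge, Fintype.linearCombination_apply, LinearMap.sum_apply]

lemma vecWedge_single (k : Fin (2 * n)) (F : Ext n p) :
    vecWedge p p' (Pi.single k 1) F = leftWedge p p' k F := by
  simp [vecWedge]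

/-- This is the Laplace expansion of the minors along their first row. -/
lemma vecWedge_wedgeVectors (a : Fin (2 * n) → ℂ) (c : Fin p → Fin (2 * n) → ℂ) :
    vecWedge p (p + 1) a (wedgeVectors c) =
      wedgeVectors (Fin.cons a c : Fin (p + 1) → Fin (2 * n) → ℂ) := by
  ext ⟨J, hJ⟩
  have hsum : vecWedge p (p + 1) a (wedgeVectors c) ⟨J, hJ⟩ =
      ∑ k ∈ J, a k * ((-1) ^ (J.filter (· < k)).card * coeff (wedgeVectors c) (J.erase k)) := by
    simp [vecWedge_apply, leftWedge_apply]
  have hminor (i : Fin (p + 1)) :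
      coeff (wedgeVectors c) (J.erase (J.orderEmbOfFin hJ i)) = Matrix.det
        ((Matrix.of fun i j => (Fin.cons a c : Fin (p + 1) → Fin (2 * n) → ℂ) i
          (J.orderEmbOfFin hJ j)).submatrix Fin.succ i.succAbove) := by
    have hcard : (J.erase (J.orderEmbOfFin hJ i)).card = p := by
      rw [Finset.card_erase_of_mem (Finset.orderEmbOfFin_mem J hJ i), hJ, add_tsub_cancel_right]
    rw [coeff, dif_pos hcard, wedgeVectors]
    congr 1
    ext x y
    simp [orderEmbOfFin_erase]
  rw [hsum, wedgeVectors, Matrix.det_succ_row_zero]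
  conv_lhs => enter [1]; rw [← Finset.map_orderEmbOfFin_univ J hJ]
  rw [Finset.sum_map]
  refine Finset.sum_congr rfl fun i _ => ?_
  simp only [RelEmbedding.coe_toEmbedding, card_filter_lt_orderEmbOfFin, Matrix.of_apply,
    Fin.cons_zero, hminor]
  ring

lemma vecWedge_wedgeVectors_eq_zero {a : Fin (2 * n) → ℂ} {c : Fin p → Fin (2 * n) → ℂ}
    (ha : a ∈ Submodule.span ℂ (Set.range c)) :
    vecWedge p (p + 1) a (wedgeVectors c) = 0 := by
  rw [← LinearMap.flip_apply, ← LinearMap.mem_ker]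
  refine Submodule.span_le.2 ?_ ha
  rintro _ ⟨i, rfl⟩
  rw [SetLike.mem_coe, LinearMap.mem_ker, LinearMap.flip_apply, vecWedge_wedgeVectors]
  ext J
  refine Matrix.det_zero_of_row_eq (i := 0) (j := i.succ) (Fin.succ_ne_zero i).symm ?_
  ext k
  simp

lemma single_eq_smul_leftWedge (J : MultiIndex n (p + 1)) {k : Fin (2 * n)} (hk : k ∈ J.1)
    (hJ : (J.1.erase k).card = p) :
    (Pi.single J 1 : Ext n (p + 1)) = ((-1 : ℂ) ^ (J.1.filter (· < k)).card) •
      leftWedge p (p + 1) k (Pi.single ⟨J.1.erase k, hJ⟩ 1) := by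
  ext J'
  simp only [Pi.smul_apply, leftWedge_apply, smul_eq_mul]
  by_cases h : J' = J
  · subst h
    simp [hk, coeff, hJ, -Finset.card_erase_of_mem, ← mul_pow]
  rw [Pi.single_eq_of_ne h]
  by_cases hk' : k ∈ J'.1
  · have hJ' : (J'.1.erase k).card = p := by
      rw [Finset.card_erase_of_mem hk', J'.2, add_tsub_cancel_right]
    have hne : (⟨J'.1.erase k, hJ'⟩ : MultiIndex n p) ≠ ⟨J.1.erase k, hJ⟩ := by
      intro h'
      refine h (Subtype.ext ?_)
      rw [← Finset.insert_erase hk, ← Finset.insert_erase hk', Subtype.mk.inj h']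
    rw [coeff, dif_pos hJ', Pi.single_eq_of_ne hne]
    simp
  · simp [hk']

lemma span_leftWedge (p : ℕ) :
    Submodule.span ℂ {ξ : Ext n (p + 1) | ∃ k F, leftWedge p (p + 1) k F = ξ} = ⊤ := by
  rw [eq_top_iff, ← (Pi.basisFun ℂ (MultiIndex n (p + 1))).span_eq, Submodule.span_le]
  rintro _ ⟨J, rfl⟩
  obtain ⟨k, hk⟩ : J.1.Nonempty := Finset.card_pos.1 (by rw [J.2]; omega)
  have hJ : (J.1.erase k).card = p := by
    rw [Finset.card_erase_of_mem hk, J.2, add_tsub_cancel_right]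
  rw [Pi.basisFun_apply, single_eq_smul_leftWedge J hk hJ]
  exact Submodule.smul_mem _ _ (Submodule.subset_span ⟨k, _, rfl⟩)

end Exterior

/-! ### The cone of strongly positive elements -/

section StronglyPositive

variable {p : ℕ} {ξ ξ' : Ext n p}

lemma IsElementaryStronglyPositive.isStronglyPositive (h : IsElementaryStronglyPositive ξ) :
    IsStronglyPositive ξ :=
  ⟨1, fun _ => 1, fun _ => ξ, fun _ => zero_le_one, fun _ => h, by simp⟩

lemma isStronglyPositive_zero : IsStronglyPositive (0 : Ext n p) :=
  ⟨0, Fin.elim0, Fin.elim0, fun l => l.elim0, fun l => l.elim0, by simp⟩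

lemma IsStronglyPositive.add (h : IsStronglyPositive ξ) (h' : IsStronglyPositive ξ') :
    IsStronglyPositive (ξ + ξ') := by
  obtain ⟨m, c, η, hc, hη, rfl⟩ := h
  obtain ⟨m', c', η', hc', hη', rfl⟩ := h'
  refine ⟨m + m', Fin.append c c', Fin.append η η', fun l => ?_, fun l => ?_, ?_⟩
  · refine Fin.addCases (fun i => ?_) (fun i => ?_) l
    · simpa using hc i
    · simpa using hc' i
  · refine Fin.addCases (fun i => ?_) (fun i => ?_) l
    · simpa using hη i
    · simpa using hη' i
  · simp [Fin.sum_univ_add]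

lemma IsStronglyPositive.smul (h : IsStronglyPositive ξ) {t : ℝ} (ht : 0 ≤ t) :
    IsStronglyPositive ((t : ℂ) • ξ) := by
  obtain ⟨m, c, η, hc, hη, rfl⟩ := h
  exact ⟨m, fun l => t * c l, η, fun l => mul_nonneg ht (hc l), hη, by
    simp only [Finset.smul_sum, smul_smul, Complex.ofReal_mul]⟩

lemma isStronglyPositive_sum {ι : Type*} (s : Finset ι) {ξ : ι → Ext n p}
    (h : ∀ i ∈ s, IsStronglyPositive (ξ i)) : IsStronglyPositive (∑ i ∈ s, ξ i) :=
  Finset.sum_induction _ IsStronglyPositive (fun _ _ => .add) isStronglyPositive_zero h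

/-! ### Exterior multiplication by pull-backs under quaternionic linear maps -/

lemma tau_add (q q' : Quaternion ℝ) : tau (q + q') = tau q + tau q' := by
  ext i j
  fin_cases i <;> fin_cases j <;> simp [tau] <;> ring

lemma tau_mul (q q' : Quaternion ℝ) : tau (q * q') = tau q * tau q' := by
  ext i j
  fin_cases i <;> fin_cases j <;>
    simp [tau, Matrix.mul_apply, Fin.sum_univ_two, Complex.ext_iff] <;> ring_nf <;> simp

lemma tau_zero : tau 0 = 0 := by
  simpa using tau_add 0 0

lemma tau_neg (q : Quaternion ℝ) : tau (-q) = -tau q :=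
  eq_neg_of_add_eq_zero_left (by rw [← tau_add, neg_add_cancel, tau_zero])

lemma tau_quatBasis (a : Fin 4) :
    tau (quatBasis a) = ![1, !![-Complex.I, 0; 0, Complex.I], !![0, -1; 1, 0],
      !![0, Complex.I; Complex.I, 0]] a := by
  ext i j
  fin_cases a <;> fin_cases i <;> fin_cases j <;> simp [tau, quatBasis]

/-- The pull-back `η^*ω̃^β` for `η(q) = ∑_l g_l q_l`. -/
def pullback (g : Fin n → Quaternion ℝ) (β : Fin 2) : Fin (2 * n) → ℂ :=
  fun j => tau (g (quatIndex j)) β (parity j)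

lemma pullback_add (g h : Fin n → Quaternion ℝ) (β : Fin 2) :
    pullback (g + h) β = pullback g β + pullback h β := by
  ext j
  simp [pullback, tau_add]

lemma pullback_smul (q : Quaternion ℝ) (g : Fin n → Quaternion ℝ) (β : Fin 2) :
    pullback (q • g) β = tau q β 0 • pullback g 0 + tau q β 1 • pullback g 1 := by
  ext j
  simp [pullback, tau_mul, Matrix.mul_apply, Fin.sum_univ_two]

lemma pullback_mem_span_tauMatrix {r : ℕ} {g : Matrix (Fin r) (Fin n) (Quaternion ℝ)}
    {g₀ : Fin n → Quaternion ℝ} (hg₀ : g₀ ∈ Submodule.span (Quaternion ℝ) (Set.range g))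
    (β : Fin 2) : pullback g₀ β ∈ Submodule.span ℂ (Set.range (tauMatrix g)) := by
  have hzero (β : Fin 2) : pullback (0 : Fin n → Quaternion ℝ) β = 0 := by
    ext j
    simp [pullback, tau_zero]
  induction hg₀ using Submodule.span_induction generalizing β with
  | mem x hx =>
    obtain ⟨i, rfl⟩ := hx
    refine Submodule.subset_span ⟨⟨2 * i + β, by omega⟩, ?_⟩
    have hindex : quatIndex (⟨2 * i + β, by omega⟩ : Fin (2 * r)) = i := by
      ext; simp only [quatIndex]; omega
    have hparity : parity (⟨2 * i + β, by omega⟩ : Fin (2 * r)) = β := by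
      ext; simp only [parity]; omega
    ext j
    simp [tauMatrix, pullback, hindex, hparity]
  | zero => rw [hzero]; exact Submodule.zero_mem _
  | add x y _ _ hx hy => rw [pullback_add]; exact Submodule.add_mem _ (hx β) (hy β)
  | smul c x _ hx =>
    rw [pullback_smul]
    exact Submodule.add_mem _ (Submodule.smul_mem _ _ (hx 0)) (Submodule.smul_mem _ _ (hx 1))

lemma tauMatrix_vecCons {r : ℕ} (g₀ : Fin n → Quaternion ℝ)
    (g : Matrix (Fin r) (Fin n) (Quaternion ℝ)) :
    (tauMatrix (Matrix.vecCons g₀ g) : Fin (2 * r + 2) → Fin (2 * n) → ℂ) =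
      Fin.cons (pullback g₀ 0)
        (Fin.cons (pullback g₀ 1) (tauMatrix g) : Fin (2 * r + 1) → Fin (2 * n) → ℂ) := by
  have hrow (i : Fin (2 * (r + 1))) (l : Fin (r + 1)) (β : Fin 2) (hl : i.1 / 2 = l)
      (hβ : i.1 % 2 = β) :
      tauMatrix (Matrix.vecCons g₀ g) i = pullback (Matrix.vecCons g₀ g l) β := by
    obtain rfl : quatIndex i = l := Fin.ext hl
    obtain rfl : parity i = β := Fin.ext hβ
    rfl
  funext i
  obtain ⟨i, hi⟩ := i
  match i with
  | 0 => exact hrow ⟨0, hi⟩ 0 0 (by simp) (by simp)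
  | 1 => exact hrow ⟨1, hi⟩ 0 1 (by simp) (by simp)
  | i + 2 =>
    have hi' : i < 2 * r := by omega
    exact hrow ⟨i + 2, hi⟩ (quatIndex ⟨i, hi'⟩).succ (parity ⟨i, hi'⟩)
      (by simp only [quatIndex, Fin.val_succ]; omega) (by simp only [parity]; omega)

/-- The exterior product `ξ ↦ g^*ω̃⁰ ∧ h^*ω̃¹ ∧ ξ`. -/
def pullbackWedge (p : ℕ) (g h : Fin n → Quaternion ℝ) : Ext n p →ₗ[ℂ] Ext n (p + 2) :=
  vecWedge (p + 1) (p + 2) (pullback g 0) ∘ₗ vecWedge p (p + 1) (pullback h 1)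

lemma IsElementaryStronglyPositive.pullbackWedge (h : IsElementaryStronglyPositive ξ)
    (g₀ : Fin n → Quaternion ℝ) : IsStronglyPositive (pullbackWedge p g₀ g₀ ξ) := by
  obtain ⟨r, rfl, g, hg, rfl⟩ := h
  rw [QuatPluripotential.pullbackWedge, LinearMap.comp_apply]
  simp only [Fin.cast_eq_self]
  by_cases hg₀ : g₀ ∈ Submodule.span (Quaternion ℝ) (Set.range g)
  · rw [vecWedge_wedgeVectors_eq_zero (pullback_mem_span_tauMatrix hg₀ 1), map_zero]
    exact isStronglyPositive_zero
  · refine IsElementaryStronglyPositive.isStronglyPositive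
      ⟨r + 1, rfl, Matrix.vecCons g₀ g, hg.finCons hg₀, ?_⟩
    rw [vecWedge_wedgeVectors, vecWedge_wedgeVectors]
    exact congrArg wedgeVectors (tauMatrix_vecCons g₀ g).symm

lemma IsStronglyPositive.pullbackWedge (h : IsStronglyPositive ξ) (g : Fin n → Quaternion ℝ) :
    IsStronglyPositive (pullbackWedge p g g ξ) := by
  obtain ⟨m, c, η, hc, hη, rfl⟩ := h
  simp only [map_sum, map_smul]
  exact isStronglyPositive_sum _ fun i _ => ((hη i).pullbackWedge g).smul (hc i)

/-! ### Strongly positive elements span the forms of even degree -/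

/-- The complex linear span of the strongly positive elements. -/
def stronglyPositiveSpan (n p : ℕ) : Submodule ℂ (Ext n p) :=
  Submodule.span ℂ {ξ | IsStronglyPositive ξ}

lemma pullbackWedge_self_mem_stronglyPositiveSpan (hξ : ξ ∈ stronglyPositiveSpan n p)
    (g : Fin n → Quaternion ℝ) : pullbackWedge p g g ξ ∈ stronglyPositiveSpan n (p + 2) := by
  refine Submodule.span_le (p := (stronglyPositiveSpan n (p + 2)).comap (pullbackWedge p g g)).2
    (fun η hη => ?_) hξ
  exact Submodule.subset_span (IsStronglyPositive.pullbackWedge hη g)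

/-- Polarization: `g^*ω̃⁰ ∧ h^*ω̃¹` is a combination of squares `f^*ω̃⁰ ∧ f^*ω̃¹`, because replacing
`h` by `-i h` multiplies `h^*ω̃⁰` by `i` and `h^*ω̃¹` by `-i`. -/
lemma pullbackWedge_mem_stronglyPositiveSpan (hξ : ξ ∈ stronglyPositiveSpan n p)
    (g h : Fin n → Quaternion ℝ) : pullbackWedge p g h ξ ∈ stronglyPositiveSpan n (p + 2) := by
  have hsymm (h : Fin n → Quaternion ℝ) :
      pullbackWedge p g h ξ + pullbackWedge p h g ξ ∈ stronglyPositiveSpan n (p + 2) := by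
    convert Submodule.sub_mem _ (Submodule.sub_mem _
      (pullbackWedge_self_mem_stronglyPositiveSpan hξ (g + h))
      (pullbackWedge_self_mem_stronglyPositiveSpan hξ g))
      (pullbackWedge_self_mem_stronglyPositiveSpan hξ h) using 1
    simp only [pullbackWedge, LinearMap.comp_apply, pullback_add, map_add, LinearMap.add_apply]
    abel
  have hskew := hsymm (-quatBasis 1 • h)
  have h₀ : pullback (-quatBasis 1 • h) 0 = Complex.I • pullback h 0 := by
    rw [pullback_smul]; simp [tau_neg, tau_quatBasis]
  have h₁ : pullback (-quatBasis 1 • h) 1 = (-Complex.I) • pullback h 1 := by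
    rw [pullback_smul]; simp [tau_neg, tau_quatBasis]
  simp only [pullbackWedge, LinearMap.comp_apply, h₀, h₁, map_smul, LinearMap.smul_apply] at hskew
  convert Submodule.smul_mem _ (1 / 2 : ℂ)
    (Submodule.add_mem _ (hsymm h) (Submodule.smul_mem _ Complex.I hskew)) using 1
  simp only [pullbackWedge, LinearMap.comp_apply, smul_add, smul_smul]
  ring_nf
  simp only [Complex.I_sq]
  module

lemma pullback_single (l : Fin n) (q : Quaternion ℝ) (β : Fin 2) (j : Fin (2 * n)) :
    pullback (Pi.single l q) β j = if quatIndex j = l then tau q β (parity j) else 0 := by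
  by_cases h : quatIndex j = l
  · subst h; simp [pullback]
  · simp [pullback, tau_zero, h]

lemma exists_pullback_zero_eq_single (k : Fin (2 * n)) :
    ∃ g : Fin n → Quaternion ℝ, pullback g 0 = Pi.single k 1 := by
  have hk (j : Fin (2 * n)) : j = k ↔ quatIndex j = quatIndex k ∧ parity j = parity k := by
    simp only [Fin.ext_iff, quatIndex, parity]
    omega
  refine ⟨Pi.single (quatIndex k) (![quatBasis 0, -quatBasis 2] (parity k)), ?_⟩
  ext j
  rw [pullback_single, Pi.single_apply]
  simp only [hk j]
  generalize parity j = b, parity k = c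
  fin_cases b <;> fin_cases c <;> simp [tau_neg, tau_quatBasis]

lemma exists_pullback_one_eq_single (k : Fin (2 * n)) :
    ∃ g : Fin n → Quaternion ℝ, pullback g 1 = Pi.single k 1 := by
  obtain ⟨g, hg⟩ := exists_pullback_zero_eq_single k
  refine ⟨quatBasis 2 • g, ?_⟩
  rw [pullback_smul, hg]
  simp [tau_quatBasis]

lemma stronglyPositiveSpan_zero : stronglyPositiveSpan n 0 = ⊤ := by
  refine eq_top_iff.2 fun F _ => ?_
  have hone : IsElementaryStronglyPositive (fun _ => 1 : Ext n 0) :=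
    ⟨0, rfl, fun i => i.elim0, linearIndependent_empty_type, by ext; simp [wedgeVectors]⟩
  have hF : F = F ⟨∅, rfl⟩ • (fun _ => 1 : Ext n 0) := by
    ext ⟨I, hI⟩
    obtain rfl := Finset.card_eq_zero.1 hI
    simp
  rw [hF]
  exact Submodule.smul_mem _ _ (Submodule.subset_span hone.isStronglyPositive)

lemma stronglyPositiveSpan_add_two (h : stronglyPositiveSpan n p = ⊤) :
    stronglyPositiveSpan n (p + 2) = ⊤ := by
  rw [eq_top_iff, ← span_leftWedge (n := n) (p + 1), Submodule.span_le]
  rintro _ ⟨j, η, rfl⟩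
  suffices hη : (⊤ : Submodule ℂ (Ext n (p + 1))) ≤ (stronglyPositiveSpan n (p + 2)).comap
      (leftWedge (p + 1) (p + 2) j).toLinearMap from hη trivial
  rw [← span_leftWedge, Submodule.span_le]
  rintro _ ⟨k, F, rfl⟩
  obtain ⟨g, hg⟩ := exists_pullback_zero_eq_single j
  obtain ⟨g', hg'⟩ := exists_pullback_one_eq_single k
  have := pullbackWedge_mem_stronglyPositiveSpan (ξ := F) (by rw [h]; trivial) g g'
  rwa [pullbackWedge, LinearMap.comp_apply, hg, hg', vecWedge_single, vecWedge_single] at this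

lemma stronglyPositiveSpan_even (r : ℕ) : stronglyPositiveSpan n (2 * r) = ⊤ := by
  induction r with
  | zero => exact stronglyPositiveSpan_zero
  | succ r ih => exact stronglyPositiveSpan_add_two ih

end StronglyPositive

/-! ### The quaternionic Hessian of a real bilinear form -/

lemma exists_eq_sum_mul_of_isPosSemidef {E : Type*} [AddCommGroup E] [Module ℝ E]
    [FiniteDimensional ℝ E] {B : LinearMap.BilinForm ℝ E} (hB : B.IsPosSemidef) :
    ∃ (m : ℕ) (f : Fin m → E →ₗ[ℝ] ℝ), ∀ x y, B x y = ∑ i, f i x * f i y := by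
  open scoped MatrixOrder in
  let b := Module.finBasis ℝ E
  have hpsd : (LinearMap.BilinForm.toMatrix b B).PosSemidef := by
    refine .of_dotProduct_mulVec_nonneg ?_ fun x => ?_
    · ext i j
      simp [LinearMap.BilinForm.toMatrix_apply, hB.isSymm.eq (b i)]
    · have := hB.nonneg (b.equivFun.symm x)
      rwa [LinearMap.BilinForm.apply_eq_dotProduct_toMatrix_mulVec b, ← Module.Basis.equivFun_apply,
        LinearEquiv.apply_symm_apply] at this
  obtain ⟨N, hN⟩ := CStarAlgebra.nonneg_iff_eq_star_mul_self.mp hpsd.nonneg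
  refine ⟨_, fun i => ∑ a, N i a • b.coord a, fun x y => ?_⟩
  rw [LinearMap.BilinForm.apply_eq_dotProduct_toMatrix_mulVec b, hN, ← Matrix.mulVec_mulVec,
    Matrix.dotProduct_mulVec, Matrix.star_eq_conjTranspose, Matrix.vecMul_conjTranspose]
  simp [dotProduct, Matrix.mulVec]

section Complexify

variable {E : Type*} [AddCommGroup E] [Module ℝ E] {B : LinearMap.BilinForm ℝ E}

/-- The complex linear extension of a real functional; the pair `z` stands for `z.1 + i z.2`. -/
def complexLin (f : E →ₗ[ℝ] ℝ) (z : E × E) : ℂ := f z.1 + Complex.I * f z.2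

/-- The complex bilinear extension of a real bilinear form. -/
def complexBilin (B : LinearMap.BilinForm ℝ E) (z w : E × E) : ℂ :=
  complexLin (B z.1) w + Complex.I * complexLin (B z.2) w

lemma complexBilin_flip (z w : E × E) : complexBilin B.flip z w = complexBilin B w z := by
  simp only [complexBilin, complexLin, LinearMap.BilinForm.flip_apply]
  ring

lemma complexBilin_sum {ι : Type*} (s : Finset ι) (B : ι → LinearMap.BilinForm ℝ E)
    (z w : E × E) : complexBilin (∑ i ∈ s, B i) z w = ∑ i ∈ s, complexBilin (B i) z w := by
  simp [complexBilin, complexLin, LinearMap.sum_apply, Finset.sum_add_distrib, Finset.mul_sum,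
    mul_add]

lemma complexBilin_eq_sum_mul {m : ℕ} {f : Fin m → E →ₗ[ℝ] ℝ}
    (hf : ∀ x y, B x y = ∑ i, f i x * f i y) (z w : E × E) :
    complexBilin B z w = ∑ i, complexLin (f i) z * complexLin (f i) w := by
  simp only [complexBilin, complexLin, hf, Complex.ofReal_sum, Complex.ofReal_mul, Finset.mul_sum,
    ← Finset.sum_add_distrib]
  exact Finset.sum_congr rfl fun i _ => by ring

end Complexify

lemma re_quatBasis (a : Fin 4) : (quatBasis a).re = ![1, 0, 0, 0] a := by
  fin_cases a <;> rfl

lemma imI_quatBasis (a : Fin 4) : (quatBasis a).imI = ![0, 1, 0, 0] a := by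
  fin_cases a <;> rfl

lemma imJ_quatBasis (a : Fin 4) : (quatBasis a).imJ = ![0, 0, 1, 0] a := by
  fin_cases a <;> rfl

lemma imK_quatBasis (a : Fin 4) : (quatBasis a).imK = ![0, 0, 0, 1] a := by
  fin_cases a <;> rfl

/-- The right multiplication `x ↦ x q` of `ℍⁿ`. -/
def rightMul (q : Quaternion ℝ) : Hn n →ₗ[ℝ] Hn n :=
  (LinearMap.mulRight ℝ q).compLeft (Fin n)

/-- The real part of the right `ℍ`-linear map `q ↦ ∑_l g_l q_l`. -/
def reLin (g : Fin n → Quaternion ℝ) : Hn n →ₗ[ℝ] ℝ :=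
  ∑ l, QuaternionAlgebra.reₗ _ _ _ ∘ₗ LinearMap.mulLeft ℝ (g l) ∘ₗ LinearMap.proj l

lemma reLin_apply (g : Fin n → Quaternion ℝ) (x : Hn n) : reLin g x = ∑ l, (g l * x l).re := by
  simp only [reLin, LinearMap.sum_apply]
  rfl

lemma reLin_single (g : Fin n → Quaternion ℝ) (l : Fin n) (q : Quaternion ℝ) :
    reLin g (Pi.single l q) = (g l * q).re := by
  rw [reLin_apply, Finset.sum_eq_single l (fun m _ hm => ?_) (by simp), Pi.single_eq_same]
  rw [Pi.single_eq_of_ne hm, mul_zero]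
  rfl

lemma reLin_comp_rightMul (g : Fin n → Quaternion ℝ) (q : Quaternion ℝ) :
    reLin g ∘ₗ rightMul q = reLin (q • g) := by
  ext x
  simp only [LinearMap.comp_apply, reLin_apply]
  refine Finset.sum_congr rfl fun l _ => ?_
  simp [rightMul]
  ring

lemma exists_eq_reLin (f : Hn n →ₗ[ℝ] ℝ) : ∃ g, f = reLin g := by
  refine ⟨fun l => ∑ a, f (Pi.single l (quatBasis a)) • star (quatBasis a),
    LinearMap.pi_ext fun l q => ?_⟩
  have hq : q = ∑ a, (star (quatBasis a) * q).re • quatBasis a := by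
    ext <;> simp [Fin.sum_univ_four, re_quatBasis, imI_quatBasis, imJ_quatBasis, imK_quatBasis]
  have hf (c : Fin 4 → ℝ) : f (Pi.single l (∑ a, c a • quatBasis a)) =
      ∑ a, f (Pi.single l (quatBasis a)) * c a := by
    simp [Fin.sum_univ_four, Pi.single_add, Pi.single_smul, mul_comm]
  rw [reLin_single]
  conv_lhs => rw [hq, hf]
  simp [Fin.sum_univ_four, add_mul, -Quaternion.re_mul]

lemma complexLin_reLin_nablaDir (g : Fin n → Quaternion ℝ) (k : Fin (2 * n)) (α : Fin 2) :
    complexLin (reLin g) (nablaDir k α) = pullback g α k := by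
  simp only [complexLin, nablaDir, pullback, Prod.map_fst, Prod.map_snd, reLin_single]
  generalize parity k = β
  fin_cases α <;> fin_cases β <;>
    simp [tau, re_quatBasis, imI_quatBasis, imJ_quatBasis, imK_quatBasis, sub_eq_add_neg, add_comm]

/-- The vector fields `∇_{k0}`, `∇_{k1}` span a right quaternionic line, on which the right
multiplication by `q` has the matrix `τ(q)`. -/
lemma complexLin_comp_rightMul_nablaDir (f : Hn n →ₗ[ℝ] ℝ) (q : Quaternion ℝ) (k : Fin (2 * n))
    (α : Fin 2) : complexLin (f ∘ₗ rightMul q) (nablaDir k α) =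
      tau q α 0 * complexLin f (nablaDir k 0) + tau q α 1 * complexLin f (nablaDir k 1) := by
  obtain ⟨g, rfl⟩ := exists_eq_reLin f
  simp [reLin_comp_rightMul, complexLin_reLin_nablaDir, pullback_smul]

lemma complexBilin_comp_rightMul_nablaDir (B : LinearMap.BilinForm ℝ (Hn n)) (q : Quaternion ℝ)
    (k j : Fin (2 * n)) (α β : Fin 2) :
    complexBilin (B.comp (rightMul q) (rightMul q)) (nablaDir k α) (nablaDir j β) =
      ∑ γ, ∑ δ, tau q α γ * tau q β δ * complexBilin B (nablaDir k γ) (nablaDir j δ) := by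
  have hright (B : LinearMap.BilinForm ℝ (Hn n)) (z : Hn n × Hn n) (j : Fin (2 * n))
      (β : Fin 2) : complexBilin (B.compRight (rightMul q)) z (nablaDir j β) =
        ∑ δ, tau q β δ * complexBilin B z (nablaDir j δ) := by
    have hB (x : Hn n) : B.compRight (rightMul q) x = B x ∘ₗ rightMul q := rfl
    simp only [complexBilin, hB, complexLin_comp_rightMul_nablaDir, Fin.sum_univ_two]
    ring
  have hcomp : B.comp (rightMul q) (rightMul q) =
      ((B.flip.compRight (rightMul q)).flip).compRight (rightMul q) := rfl
  rw [hcomp, hright]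
  simp only [complexBilin_flip, hright, Finset.mul_sum]
  rw [Finset.sum_comm]
  exact Finset.sum_congr rfl fun _ _ => Finset.sum_congr rfl fun _ _ => by ring

/-- Exterior multiplication by `∑_{k,j} B(∇_{kα}, ∇_{jβ}) ω^k ∧ ω^j`; for the Hessian `B` of a
function `u` and `α = 0`, `β = 1` this is the product with `△u`. -/
def hessWedge (p : ℕ) (B : LinearMap.BilinForm ℝ (Hn n)) (α β : Fin 2) :
    Ext n p →ₗ[ℂ] Ext n (p + 2) :=
  ∑ k : Fin (2 * n) × Fin (2 * n), complexBilin B (nablaDir k.1 α) (nablaDir k.2 β) •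
    ((leftWedge (p + 1) (p + 2) k.1).toLinearMap ∘ₗ (leftWedge p (p + 1) k.2).toLinearMap)

section HessWedge

variable {p : ℕ} {B : LinearMap.BilinForm ℝ (Hn n)} {ξ : Ext n p}

lemma hessWedge_apply (α β : Fin 2) : hessWedge p B α β ξ =
    ∑ k, ∑ j, complexBilin B (nablaDir k α) (nablaDir j β) •
      leftWedge (p + 1) (p + 2) k (leftWedge p (p + 1) j ξ) := by
  simp [hessWedge, LinearMap.sum_apply, Fintype.sum_prod_type]

lemma hessWedge_sum {ι : Type*} (s : Finset ι) (B : ι → LinearMap.BilinForm ℝ (Hn n))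
    (α β : Fin 2) : hessWedge p (∑ i ∈ s, B i) α β = ∑ i ∈ s, hessWedge p (B i) α β := by
  simp only [hessWedge, complexBilin_sum, Finset.sum_smul]
  exact Finset.sum_comm

lemma hessWedge_swap (hB : B.IsSymm) (α β : Fin 2) :
    hessWedge p B α β = -hessWedge p B β α := by
  have hcomm (z w : Hn n × Hn n) : complexBilin B z w = complexBilin B w z := by
    rw [← complexBilin_flip]
    exact congrArg (complexBilin · w z) (LinearMap.BilinForm.isSymm_iff_flip.1 hB)
  refine LinearMap.ext fun ξ => ?_
  rw [LinearMap.neg_apply, hessWedge_apply, hessWedge_apply, Finset.sum_comm]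
  simp only [← Finset.sum_neg_distrib]
  refine Finset.sum_congr rfl fun k _ => Finset.sum_congr rfl fun j _ => ?_
  rw [hcomm, leftWedge_anticomm, smul_neg]

lemma hessWedge_comp_rightMul (hB : B.IsSymm) (q : Quaternion ℝ) :
    hessWedge p (B.comp (rightMul q) (rightMul q)) 0 1 =
      ((Quaternion.normSq q : ℝ) : ℂ) • hessWedge p B 0 1 := by
  have hself (α : Fin 2) : hessWedge p B α α = 0 := by
    have := hessWedge_swap hB (p := p) α α
    rwa [eq_neg_iff_add_eq_zero, ← two_smul ℂ, smul_eq_zero_iff_right two_ne_zero] at this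
  have hexpand : hessWedge p (B.comp (rightMul q) (rightMul q)) 0 1 =
      ∑ γ, ∑ δ, (tau q 0 γ * tau q 1 δ) • hessWedge p B γ δ := by
    refine LinearMap.ext fun ξ => ?_
    simp only [hessWedge_apply, complexBilin_comp_rightMul_nablaDir, Fin.sum_univ_two, add_smul,
      mul_smul, Finset.sum_add_distrib, LinearMap.add_apply, LinearMap.smul_apply,
      Finset.smul_sum]
  have hdet : tau q 0 0 * tau q 1 1 - tau q 0 1 * tau q 1 0 =
      ((Quaternion.normSq q : ℝ) : ℂ) := by
    simp only [tau, Quaternion.normSq_def', Complex.ofReal_add, Complex.ofReal_pow]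
    simp
    linear_combination (-(q.imI : ℂ) ^ 2 - (q.imK : ℂ) ^ 2) * Complex.I_sq
  simp only [hexpand, Fin.sum_univ_two, hself, hessWedge_swap hB 1 0, ← hdet]
  module

lemma hessWedge_eq_sum_pullbackWedge {m : ℕ} {g : Fin m → Fin n → Quaternion ℝ}
    (hg : ∀ x y, B x y = ∑ i, reLin (g i) x * reLin (g i) y) :
    hessWedge p B 0 1 = ∑ i, pullbackWedge p (g i) (g i) := by
  refine LinearMap.ext fun ξ => ?_
  simp only [hessWedge_apply, complexBilin_eq_sum_mul hg, complexLin_reLin_nablaDir,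
    LinearMap.sum_apply, pullbackWedge, LinearMap.comp_apply, vecWedge_apply, map_sum, map_smul,
    Finset.sum_smul, Finset.smul_sum, smul_smul]
  simp only [mul_comm]
  exact (Finset.sum_comm.trans (Finset.sum_congr rfl fun _ _ => Finset.sum_comm)).trans
    Finset.sum_comm

/-- Averaging a symmetric form over the right multiplications by `1, i, j, k` only multiplies its
quaternionic Hessian by four, and the average is a sum of squares. -/
theorem IsStronglyPositive.hessWedge (hB : B.IsSymm)
    (hpos : ∀ x, 0 ≤ ∑ e, B (rightMul (quatBasis e) x) (rightMul (quatBasis e) x))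
    (hξ : IsStronglyPositive ξ) : IsStronglyPositive (hessWedge p B 0 1 ξ) := by
  let A : LinearMap.BilinForm ℝ (Hn n) :=
    ∑ e, B.comp (rightMul (quatBasis e)) (rightMul (quatBasis e))
  have hA (x y) : A x y = ∑ e, B (rightMul (quatBasis e) x) (rightMul (quatBasis e) y) := by
    simp [A, LinearMap.sum_apply]
  have hApos : A.IsPosSemidef :=
    { eq := fun x y => by simp [hA, hB.eq (rightMul _ x)]
      nonneg := fun x => (hpos x).trans_eq (hA x x).symm }
  obtain ⟨m, f, hf⟩ := exists_eq_sum_mul_of_isPosSemidef hApos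
  choose g hg using fun i => exists_eq_reLin (f i)
  have hfour : QuatPluripotential.hessWedge p A 0 1 =
      (4 : ℂ) • QuatPluripotential.hessWedge p B 0 1 := by
    simp only [A, hessWedge_sum, hessWedge_comp_rightMul hB, ← Finset.sum_smul]
    congr 1
    simp [Fin.sum_univ_four, Quaternion.normSq_def', re_quatBasis, imI_quatBasis, imJ_quatBasis,
      imK_quatBasis]
    norm_num
  have hsum : QuatPluripotential.hessWedge p B 0 1 =
      ((1 / 4 : ℝ) : ℂ) • ∑ i, QuatPluripotential.pullbackWedge p (g i) (g i) := by
    rw [← hessWedge_eq_sum_pullbackWedge (B := A) (by simpa only [← hg] using hf), hfour, smul_smul]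
    norm_num
  rw [hsum, LinearMap.smul_apply, LinearMap.sum_apply]
  exact (isStronglyPositive_sum _ fun i _ => hξ.pullbackWedge (g i)).smul (by norm_num)

end HessWedge

/-! ### Test forms and integration by parts against closed currents -/

/-- A smooth form that vanishes wherever the test form `φ` does, as a test form. -/
def testFormOf {p p' : ℕ} (φ : TestForm Ω p) (f : Hn n → Ext n p') (hf : ContDiff ℝ ∞ f)
    (h : ∀ x, φ x = 0 → f x = 0) : TestForm Ω p' :=
  have hs : tsupport f ⊆ tsupport φ := closure_mono fun x hx hφ => hx (h x hφ)
  ⟨f, hf, φ.hasCompactSupport.mono' (subset_closure.trans hs), hs.trans φ.tsupport_subset⟩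

section DFun

variable {p₁ p₂ p₃ : ℕ} {f : Hn n → Ext n p₁}

lemma contDiff_leftWedge_comp (k : Fin (2 * n)) (hf : ContDiff ℝ ∞ f) :
    ContDiff ℝ ∞ (fun x => leftWedge p₁ p₂ k (f x)) :=
  ((leftWedge p₁ p₂ k).restrictScalars ℝ).contDiff.comp hf

lemma dFun_dFun (α β : Fin 2) (hf : ContDiff ℝ ∞ f) (x : Hn n) :
    dFun p₂ p₃ α (dFun p₁ p₂ β f) x = ∑ k, ∑ j, leftWedge p₂ p₃ k
      (leftWedge p₁ p₂ j (complexDeriv (nablaDir k α) (complexDeriv (nablaDir j β) f) x)) := by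
  have hd (j : Fin (2 * n)) : ContDiff ℝ ∞ (complexDeriv (nablaDir j β) f) :=
    contDiff_complexDeriv (nablaDir j β) hf
  refine Finset.sum_congr rfl fun k _ => ?_
  have hk : complexDeriv (nablaDir k α) (dFun p₁ p₂ β f) x = ∑ j, leftWedge p₁ p₂ j
      (complexDeriv (nablaDir k α) (complexDeriv (nablaDir j β) f) x) :=
    (complexDeriv_sum _ _
      (fun j _ => (contDiff_leftWedge_comp j (hd j)).differentiable (by simp)) x).trans
      (Finset.sum_congr rfl fun j _ =>
        complexDeriv_clm_comp _ _ ((hd j).differentiable (by simp)) x)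
  rw [hk, map_sum]

lemma dFun_anticomm (α β : Fin 2) (hf : ContDiff ℝ ∞ f) (x : Hn n) :
    dFun p₂ p₃ α (dFun p₁ p₂ β f) x = -dFun p₂ p₃ β (dFun p₁ p₂ α f) x := by
  rw [dFun_dFun _ _ hf, dFun_dFun _ _ hf, Finset.sum_comm]
  simp only [← Finset.sum_neg_distrib]
  refine Finset.sum_congr rfl fun k _ => Finset.sum_congr rfl fun j _ => ?_
  rw [leftWedge_anticomm, complexDeriv_comm _ _ hf]

/-- The product `d_α v ∧ f` of the differential of a function and a form. -/
def gradWedge (p p' : ℕ) (α : Fin 2) (v : Hn n → ℂ) (f : Hn n → Ext n p) (x : Hn n) : Ext n p' :=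
  ∑ k, complexDeriv (nablaDir k α) v x • leftWedge p p' k (f x)

lemma contDiff_gradWedge (α : Fin 2) {v : Hn n → ℂ} (hv : ContDiff ℝ ∞ v) (hf : ContDiff ℝ ∞ f) :
    ContDiff ℝ ∞ (gradWedge p₁ p₂ α v f) :=
  ContDiff.sum fun k _ => (contDiff_complexDeriv _ hv).smul (contDiff_leftWedge_comp k hf)

lemma dFun_smul (α : Fin 2) {v : Hn n → ℂ} (hv : Differentiable ℝ v) (hf : Differentiable ℝ f)
    (x : Hn n) : dFun p₁ p₂ α (fun y => v y • f y) x =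
      v x • dFun p₁ p₂ α f x + gradWedge p₁ p₂ α v f x := by
  simp only [dFun, gradWedge, complexDeriv_smul _ hv hf, map_add, map_smul,
    Finset.sum_add_distrib, Finset.smul_sum]

lemma dFun_gradWedge (α β : Fin 2) {v : Hn n → ℂ} (hv : ContDiff ℝ ∞ v) (hf : ContDiff ℝ ∞ f)
    (x : Hn n) : dFun p₂ p₃ α (gradWedge p₁ p₂ β v f) x =
      ∑ k, ∑ j, complexDeriv (nablaDir k α) (complexDeriv (nablaDir j β) v) x •
        leftWedge p₂ p₃ k (leftWedge p₁ p₂ j (f x)) - gradWedge p₂ p₃ β v (dFun p₁ p₂ α f) x := by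
  have hderiv (k : Fin (2 * n)) : complexDeriv (nablaDir k α) (gradWedge p₁ p₂ β v f) x =
      ∑ j, (complexDeriv (nablaDir j β) v x •
          leftWedge p₁ p₂ j (complexDeriv (nablaDir k α) f x) +
        complexDeriv (nablaDir k α) (complexDeriv (nablaDir j β) v) x •
          leftWedge p₁ p₂ j (f x)) := by
    have hv' (j : Fin (2 * n)) := contDiff_complexDeriv (nablaDir j β) hv
    have hf' (j : Fin (2 * n)) := contDiff_leftWedge_comp (p₂ := p₂) j hf
    refine (complexDeriv_sum _ _
      (fun j _ => ((hv' j).smul (hf' j)).differentiable (by simp)) x).trans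
      (Finset.sum_congr rfl fun j _ => ?_)
    rw [← complexDeriv_clm_comp _ _ (hf.differentiable (by simp))]
    exact complexDeriv_smul _ ((hv' j).differentiable (by simp))
      ((hf' j).differentiable (by simp)) x
  have hswap : gradWedge p₂ p₃ β v (dFun p₁ p₂ α f) x = -∑ k, ∑ j,
      complexDeriv (nablaDir j β) v x • leftWedge p₂ p₃ k
        (leftWedge p₁ p₂ j (complexDeriv (nablaDir k α) f x)) := by
    rw [Finset.sum_comm, ← Finset.sum_neg_distrib]
    refine Finset.sum_congr rfl fun j _ => ?_
    simp only [dFun, map_sum, Finset.smul_sum, ← Finset.sum_neg_distrib, ← smul_neg]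
    simp only [leftWedge_anticomm j]
  simp only [dFun, hderiv, map_sum, map_add, map_smul, Finset.sum_add_distrib] at hswap ⊢
  rw [hswap, sub_neg_eq_add, add_comm]

end DFun

lemma dForm_anticomm {p₁ p₂ p₃ : ℕ} (α β : Fin 2) (φ : TestForm Ω p₁) :
    dForm p₂ p₃ α (dForm p₁ p₂ β φ) = -dForm p₂ p₃ β (dForm p₁ p₂ α φ) := by
  ext1 x
  simp only [neg_apply, coe_dForm]
  exact dFun_anticomm α β φ.contDiff x

lemma dForm_dForm_self {p₁ p₂ p₃ : ℕ} (α : Fin 2) (φ : TestForm Ω p₁) :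
    dForm p₂ p₃ α (dForm p₁ p₂ α φ) = 0 := by
  ext1 x
  exact self_eq_neg.1 (congrArg (fun ψ : TestForm Ω p₃ => ψ x) (dForm_anticomm α α φ))

lemma Current.isClosed_laplace {p : ℕ} (F : Current Ω p) : F.laplace.IsClosed := by
  intro α
  ext φ
  fin_cases α
  · simp [Current.d, Current.laplace, dForm_anticomm 1 0, dForm_dForm_self]
  · simp [Current.d, Current.laplace, dForm_dForm_self]

/-- The Hessian of a real function, as a bilinear form. -/
def hessian {E : Type*} [NormedAddCommGroup E] [NormedSpace ℝ E] (v : E → ℝ) (x : E) :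
    LinearMap.BilinForm ℝ E :=
  (fderiv ℝ (fderiv ℝ v) x).toBilinForm

section Hessian

variable {E : Type*} [NormedAddCommGroup E] [NormedSpace ℝ E] {v : E → ℝ}

lemma isSymm_hessian (hv : ContDiff ℝ 2 v) (x : E) : (hessian v x).IsSymm :=
  ⟨(hv.contDiffAt.isSymmSndFDerivAt (by simp)).eq⟩

lemma contDiff_ofReal_comp (hv : ContDiff ℝ ∞ v) : ContDiff ℝ ∞ fun x => (v x : ℂ) :=
  Complex.ofRealCLM.contDiff.comp hv

lemma fderiv_fderiv_ofReal (hv : ContDiff ℝ ∞ v) (x y z : E) :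
    fderiv ℝ (fderiv ℝ fun t => (v t : ℂ)) x y z = (hessian v x y z : ℂ) := by
  have hfderiv : (fderiv ℝ fun t => (v t : ℂ)) = fun t => Complex.ofRealCLM.comp (fderiv ℝ v t) :=
    funext fun t => (Complex.ofRealCLM.hasFDerivAt.comp t
      (hv.differentiable (by simp) t).hasFDerivAt).fderiv
  have hd : DifferentiableAt ℝ (fderiv ℝ v) x :=
    (hv.fderiv_right (m := ∞) (by simp)).differentiable (by simp) x
  rw [hfderiv]
  exact DFunLike.congr_fun (DFunLike.congr_fun
    ((ContinuousLinearMap.compL ℝ E ℝ ℂ Complex.ofRealCLM).hasFDerivAt.comp x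
      hd.hasFDerivAt).fderiv y) z

lemma complexDeriv_complexDeriv_ofReal (hv : ContDiff ℝ ∞ v) (z w : E × E) (x : E) :
    complexDeriv z (complexDeriv w fun t => (v t : ℂ)) x = complexBilin (hessian v x) z w := by
  simp only [complexDeriv_complexDeriv z w (contDiff_ofReal_comp hv), fderiv_fderiv_ofReal hv,
    complexBilin, complexLin, smul_eq_mul]

end Hessian

section IntegrationByParts

variable {m : ℕ} {v : Hn n → ℝ}

/-- The product of a smooth function and a test form. -/
def smulForm (v : Hn n → ℝ) (hv : ContDiff ℝ ∞ v) (φ : TestForm Ω m) : TestForm Ω m :=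
  testFormOf φ (fun x => (v x : ℂ) • φ x) ((contDiff_ofReal_comp hv).smul φ.contDiff)
    fun x hx => by simp [hx]

lemma smulForm_apply (hv : ContDiff ℝ ∞ v) (φ : TestForm Ω m) (x : Hn n) :
    smulForm v hv φ x = (v x : ℂ) • φ x := rfl

lemma dFun_gradWedge_ofReal (hv : ContDiff ℝ ∞ v) (η : TestForm Ω m) (x : Hn n) :
    dFun (m + 1) (m + 2) 1 (gradWedge m (m + 1) 0 (fun t => (v t : ℂ)) η) x =
      -hessWedge m (hessian v x) 0 1 (η x) -
        gradWedge (m + 1) (m + 2) 0 (fun t => (v t : ℂ)) (dFun m (m + 1) 1 η) x := by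
  rw [dFun_gradWedge _ _ (contDiff_ofReal_comp hv) η.contDiff, ← LinearMap.neg_apply,
    ← hessWedge_swap (isSymm_hessian (hv.of_le ENat.LEInfty.out) x), hessWedge_apply]
  simp only [complexDeriv_complexDeriv_ofReal hv]

lemma contDiff_hessWedge (hv : ContDiff ℝ ∞ v) (η : TestForm Ω m) :
    ContDiff ℝ ∞ fun x => hessWedge m (hessian v x) 0 1 (η x) := by
  simp only [hessWedge_apply, ← complexDeriv_complexDeriv_ofReal hv]
  exact ContDiff.sum fun k _ => ContDiff.sum fun j _ =>
    (contDiff_complexDeriv _ (contDiff_complexDeriv _ (contDiff_ofReal_comp hv))).smul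
      (contDiff_leftWedge_comp k (contDiff_leftWedge_comp j η.contDiff))

/-- The test form `△v ∧ η`. -/
def laplaceWedgeForm (v : Hn n → ℝ) (hv : ContDiff ℝ ∞ v) (η : TestForm Ω m) :
    TestForm Ω (m + 2) :=
  testFormOf η (fun x => hessWedge m (hessian v x) 0 1 (η x)) (contDiff_hessWedge hv η)
    fun x hx => by simp [hx]

/-- Up to the exact forms `d₀(v d₁η)` and `d₁(d₀v ∧ η)`, the forms `v △η` and `△v ∧ η` agree. -/
theorem apply_smulForm_laplace (T : TestForm Ω (m + 2) →L[ℂ] ℂ)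
    (hT : ∀ α ψ, T (dForm (m + 1) (m + 2) α ψ) = 0) (hv : ContDiff ℝ ∞ v) (η : TestForm Ω m) :
    T (smulForm v hv (dForm (m + 1) (m + 2) 0 (dForm m (m + 1) 1 η))) =
      T (laplaceWedgeForm v hv η) := by
  let ψ : TestForm Ω (m + 1) := testFormOf η (gradWedge m (m + 1) 0 (fun x => (v x : ℂ)) η)
    (contDiff_gradWedge 0 (contDiff_ofReal_comp hv) η.contDiff)
    fun x hx => by simp [gradWedge, hx]
  have hexact : dForm (m + 1) (m + 2) 0 (smulForm v hv (dForm m (m + 1) 1 η)) +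
      dForm (m + 1) (m + 2) 1 ψ =
        smulForm v hv (dForm (m + 1) (m + 2) 0 (dForm m (m + 1) 1 η)) -
          laplaceWedgeForm v hv η := by
    ext1 x
    change dForm (m + 1) (m + 2) 0 (smulForm v hv (dForm m (m + 1) 1 η)) x +
      dForm (m + 1) (m + 2) 1 ψ x = (v x : ℂ) • dForm (m + 1) (m + 2) 0 (dForm m (m + 1) 1 η) x -
        hessWedge m (hessian v x) 0 1 (η x)
    have hsmul := dFun_smul (p₂ := m + 2) 0 ((contDiff_ofReal_comp hv).differentiable (by simp))
      ((dForm m (m + 1) 1 η).contDiff.differentiable (by simp)) x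
    have hgrad := dFun_gradWedge_ofReal hv η x
    rw [coe_dForm, coe_dForm, coe_dForm]
    refine (congrArg₂ (· + ·) hsmul hgrad).trans ?_
    rw [coe_dForm]
    abel
  have hT0 := congrArg T hexact
  rw [map_add, hT, hT, map_sub, add_zero] at hT0
  exact sub_eq_zero.1 hT0.symm

end IntegrationByParts

/-! ### Mollification by radial weights -/

section RadialMean

variable {E : Type*} [NormedAddCommGroup E]

lemma superlevel_eq_closedBall [ProperSpace E] {ρ : E → ℝ} {ε t : ℝ} (hρ : Continuous ρ)
    (hanti : ∀ x y, ‖x‖ ≤ ‖y‖ → ρ y ≤ ρ x) (hsupp : ∀ x, ε < ‖x‖ → ρ x = 0) (ht : 0 < t)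
    (hne : {x | t ≤ ρ x}.Nonempty) :
    ∃ r, 0 ≤ r ∧ r ≤ ε ∧ {x | t ≤ ρ x} = Metric.closedBall 0 r := by
  have hsub : {x | t ≤ ρ x} ⊆ Metric.closedBall 0 ε := fun x hx => by
    rw [mem_closedBall_zero_iff]
    by_contra! h
    exact ht.not_ge (hsupp x h ▸ hx)
  obtain ⟨x₀, hx₀, hmax⟩ := ((isCompact_closedBall (0 : E) ε).of_isClosed_subset
    (isClosed_le continuous_const hρ) hsub).exists_isMaxOn hne continuous_norm.continuousOn
  refine ⟨‖x₀‖, norm_nonneg x₀, mem_closedBall_zero_iff.1 (hsub hx₀), ?_⟩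
  ext x
  rw [mem_closedBall_zero_iff]
  exact ⟨fun hx => hmax hx, fun hx => le_trans hx₀ (hanti _ _ hx)⟩

/-- By the layer cake formula, a radially decreasing weight is a mixture of indicators of balls. -/
lemma lintegral_radial_mul_le [ProperSpace E] [MeasurableSpace E] [BorelSpace E] {μ : Measure E}
    [NullSingletonClass μ] {f : E → ℝ≥0∞} (hf : Measurable f) {C : ℝ≥0∞} {ε : ℝ} {ρ : E → ℝ}
    (hρ : Continuous ρ) (hnonneg : ∀ x, 0 ≤ ρ x) (hanti : ∀ x y, ‖x‖ ≤ ‖y‖ → ρ y ≤ ρ x)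
    (hsupp : ∀ x, ε < ‖x‖ → ρ x = 0)
    (h : ∀ r, 0 < r → r ≤ ε →
      ∫⁻ x in Metric.closedBall 0 r, f x ∂μ ≤ μ (Metric.closedBall 0 r) * C) :
    ∫⁻ x, ENNReal.ofReal (ρ x) * f x ∂μ ≤ (∫⁻ x, ENNReal.ofReal (ρ x) ∂μ) * C := by
  have superlevel_le (t : ℝ) (ht : 0 < t) :
      μ.withDensity f {x | t ≤ ρ x} ≤ μ {x | t ≤ ρ x} * C := by
    rcases Set.eq_empty_or_nonempty {x | t ≤ ρ x} with he | hne
    · simp [he]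
    obtain ⟨r, hr, hrε, heq⟩ := superlevel_eq_closedBall hρ hanti hsupp ht hne
    rw [heq, withDensity_apply _ measurableSet_closedBall]
    rcases hr.eq_or_lt with rfl | hpos
    · simp
    · exact h r hpos hrε
  have hdensity : ∫⁻ x, ENNReal.ofReal (ρ x) * f x ∂μ =
      ∫⁻ x, ENNReal.ofReal (ρ x) ∂μ.withDensity f := by
    rw [lintegral_withDensity_eq_lintegral_mul _ hf hρ.measurable.ennreal_ofReal]
    simp only [Pi.mul_apply, mul_comm]
  rw [hdensity, lintegral_eq_lintegral_meas_le _ (.of_forall hnonneg) hρ.aemeasurable,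
    lintegral_eq_lintegral_meas_le _ (.of_forall hnonneg) hρ.aemeasurable, ← lintegral_mul_const]
  · exact setLIntegral_mono' measurableSet_Ioi superlevel_le
  · exact Antitone.measurable fun s t hst => measure_mono fun x hx => le_trans hst hx

end RadialMean

lemma lmarginal_prod_mul_le {ι : Type*} [DecidableEq ι] {X : ι → Type*}
    [∀ i, MeasurableSpace (X i)] {μ : ∀ i, Measure (X i)} [∀ i, SigmaFinite (μ i)]
    {w : ∀ i, X i → ℝ≥0∞} (hw : ∀ i, Measurable (w i)) (hw_le : ∀ i, ∫⁻ t, w i t ∂μ i ≤ 1)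
    (a : ∀ i, X i) (s : Finset ι) {f : (∀ i, X i) → ℝ≥0∞} (hf : Measurable f)
    (h : ∀ x i, ∫⁻ t, w i t * f (Function.update x i t) ∂μ i ≤ f (Function.update x i (a i)))
    (x : ∀ i, X i) :
    (∫⋯∫⁻_s, (fun y => (∏ i ∈ s, w i (y i)) * f y) ∂μ) x ≤ f (s.piecewise a x) := by
  induction s using Finset.induction_on generalizing f x with
  | empty => simp
  | insert i s hi ih =>
    have hprod (s : Finset ι) : Measurable fun y : ∀ i, X i => ∏ j ∈ s, w j (y j) :=
      Finset.measurable_prod _ fun j _ => (hw j).comp (measurable_pi_apply j)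
    have inner_le (y : ∀ i, X i) : ∫⁻ t, (∏ j ∈ insert i s, w j (Function.update y i t j)) *
        f (Function.update y i t) ∂μ i ≤
          (∏ j ∈ s, w j (y j)) * f (Function.update y i (a i)) := by
      have hsplit (t : X i) : ∏ j ∈ insert i s, w j (Function.update y i t j) =
          (∏ j ∈ s, w j (y j)) * w i t := by
        rw [Finset.prod_insert hi, Function.update_self, mul_comm]
        congr 1
        exact Finset.prod_congr rfl fun j hj => by
          rw [Function.update_of_ne (ne_of_mem_of_not_mem hj hi)]
      simp only [hsplit, mul_assoc]
      have hinner : Measurable fun t => w i t * f (Function.update y i t) :=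
        (hw i).mul (hf.comp (measurable_update y))
      rw [lintegral_const_mul _ hinner]
      exact mul_le_mul_right (h y i) _
    rw [lmarginal_insert' _ ((hprod _).fun_mul hf) hi, Finset.piecewise_insert]
    refine (lmarginal_mono inner_le x).trans
      (ih (f := fun y => f (Function.update y i (a i))) (hf.comp measurable_update_left)
        (fun y j => ?_) x)
    rcases eq_or_ne j i with rfl | hj
    · simp only [Function.update_idem]
      rw [lintegral_mul_const _ (hw j)]
      exact mul_le_of_le_one_left' (hw_le j)
    · simp only [Function.update_comm hj]
      exact h _ j

section RadialMollifier

variable {E : Type*} [NormedAddCommGroup E] {ε : ℝ}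

/-- The radially decreasing weight supported in the closed ball of radius `ε`. -/
def radialBump (ε : ℝ) (x : E) : ℝ := expNegInvGlue (ε ^ 2 - ‖x‖ ^ 2)

lemma radialBump_nonneg (ε : ℝ) (x : E) : 0 ≤ radialBump ε x := expNegInvGlue.nonneg _

lemma radialBump_eq_zero (hε : 0 < ε) {x : E} (h : ε < ‖x‖) : radialBump ε x = 0 :=
  expNegInvGlue.zero_of_nonpos (by nlinarith)

lemma radialBump_anti (ε : ℝ) {x y : E} (h : ‖x‖ ≤ ‖y‖) : radialBump ε y ≤ radialBump ε x :=
  expNegInvGlue.monotone (by gcongr)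

lemma hasCompactSupport_radialBump [ProperSpace E] (hε : 0 < ε) :
    HasCompactSupport (radialBump ε : E → ℝ) :=
  .intro (isCompact_closedBall 0 ε) fun _ hx => radialBump_eq_zero hε (by simpa using hx)

lemma contDiff_radialBump [InnerProductSpace ℝ E] (ε : ℝ) : ContDiff ℝ ∞ (radialBump ε : E → ℝ) :=
  expNegInvGlue.contDiff.comp (contDiff_const.sub (contDiff_norm_sq ℝ))

variable [MeasureSpace E]

/-- The weight `radialBump ε`, normalized to have integral `1`. -/
def radialMollifier (ε : ℝ) (x : E) : ℝ := (∫ y : E, radialBump ε y)⁻¹ * radialBump ε x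

lemma radialMollifier_nonneg (ε : ℝ) (x : E) : 0 ≤ radialMollifier ε x :=
  mul_nonneg (inv_nonneg.2 (integral_nonneg (radialBump_nonneg ε))) (radialBump_nonneg ε x)

lemma radialMollifier_eq_zero (hε : 0 < ε) {x : E} (h : ε < ‖x‖) : radialMollifier ε x = 0 := by
  rw [radialMollifier, radialBump_eq_zero hε h, mul_zero]

lemma radialMollifier_anti (ε : ℝ) {x y : E} (h : ‖x‖ ≤ ‖y‖) :
    radialMollifier ε y ≤ radialMollifier ε x :=
  mul_le_mul_of_nonneg_left (radialBump_anti ε h)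
    (inv_nonneg.2 (integral_nonneg (radialBump_nonneg ε)))

lemma contDiff_radialMollifier [InnerProductSpace ℝ E] (ε : ℝ) :
    ContDiff ℝ ∞ (radialMollifier ε : E → ℝ) :=
  contDiff_const.mul (contDiff_radialBump ε)

variable [InnerProductSpace ℝ E] [ProperSpace E] [BorelSpace E]
  [IsFiniteMeasureOnCompacts (volume : Measure E)]

lemma integrable_radialBump (hε : 0 < ε) : Integrable (radialBump ε : E → ℝ) :=
  (contDiff_radialBump ε).continuous.integrable_of_hasCompactSupport
    (hasCompactSupport_radialBump hε)

variable [(volume : Measure E).IsOpenPosMeasure]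

lemma integral_radialBump_pos (hε : 0 < ε) : 0 < ∫ x : E, radialBump ε x :=
  (contDiff_radialBump ε).continuous.integral_pos_of_hasCompactSupport_nonneg_nonzero
    (hasCompactSupport_radialBump hε) (radialBump_nonneg ε)
    (x := 0) (expNegInvGlue.pos_of_pos (by simpa using pow_pos hε 2)).ne'

lemma integral_radialMollifier (hε : 0 < ε) : ∫ x : E, radialMollifier ε x = 1 := by
  simp only [radialMollifier]
  rw [integral_const_mul, inv_mul_cancel₀ (integral_radialBump_pos hε).ne']

lemma lintegral_radialMollifier (hε : 0 < ε) :
    ∫⁻ x : E, ENNReal.ofReal (radialMollifier ε x) = 1 := by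
  have hint : Integrable (radialMollifier ε : E → ℝ) := (integrable_radialBump hε).const_mul _
  rw [← ofReal_integral_eq_lintegral_ofReal hint (.of_forall (radialMollifier_nonneg ε)),
    integral_radialMollifier hε, ENNReal.ofReal_one]

end RadialMollifier

/-- The product mollifier on `ℍⁿ`. It is not radial, but radial in each variable, so that it
respects mean value inequalities on right quaternionic lines. -/
def mollifier (ε : ℝ) (y : Hn n) : ℝ := ∏ l, radialMollifier ε (y l)

lemma mollifier_nonneg (ε : ℝ) (y : Hn n) : 0 ≤ mollifier ε y :=
  Finset.prod_nonneg fun l _ => radialMollifier_nonneg ε (y l)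

lemma contDiff_mollifier (ε : ℝ) : ContDiff ℝ ∞ (mollifier ε : Hn n → ℝ) :=
  contDiff_prod fun l _ => (contDiff_radialMollifier ε).comp (contDiff_apply ℝ (Quaternion ℝ) l)

section Mollifier

variable {ε : ℝ}

lemma mollifier_eq_zero (hε : 0 < ε) {y : Hn n} (h : ε < ‖y‖) : mollifier ε y = 0 := by
  obtain ⟨l, hl⟩ : ∃ l, ε < ‖y l‖ := by
    by_contra! hcon
    exact h.not_ge ((pi_norm_le_iff_of_nonneg hε.le).2 hcon)
  exact Finset.prod_eq_zero (Finset.mem_univ l) (radialMollifier_eq_zero hε hl)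

lemma hasCompactSupport_mollifier (hε : 0 < ε) :
    HasCompactSupport (mollifier ε : Hn n → ℝ) :=
  .intro (isCompact_closedBall 0 ε) fun _ hy => mollifier_eq_zero hε (by simpa using hy)

lemma integral_mollifier (hε : 0 < ε) : ∫ y : Hn n, mollifier ε y = 1 := by
  simp only [mollifier]
  rw [integral_fintype_prod_volume_eq_pow, integral_radialMollifier hε, one_pow]

lemma integrable_mollifier (hε : 0 < ε) : Integrable (mollifier ε : Hn n → ℝ) :=
  (contDiff_mollifier ε).continuous.integrable_of_hasCompactSupport (hasCompactSupport_mollifier hε)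

lemma lintegral_mollifier_mul_le (hε : 0 < ε) {F : Hn n → ℝ≥0∞} (hF : Measurable F)
    (h : ∀ y i, Function.update y i 0 ∈ Metric.closedBall 0 ε →
      ∫⁻ ξ, ENNReal.ofReal (radialMollifier ε ξ) * F (Function.update y i ξ) ≤
        F (Function.update y i 0)) :
    ∫⁻ y, ENNReal.ofReal (mollifier ε y) * F y ≤ F 0 := by
  classical
  -- With the value `⊤` outside the ball the mean value inequality holds everywhere.
  set f : Hn n → ℝ≥0∞ := fun y => if y ∈ Metric.closedBall 0 ε then F y else ⊤
  have f_of_mem {y : Hn n} (hy : y ∈ Metric.closedBall 0 ε) : f y = F y := if_pos hy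
  have hf : Measurable f := Measurable.ite measurableSet_closedBall hF measurable_const
  have coordinate_le (y : Hn n) (i : Fin n) :
      ∫⁻ ξ, ENNReal.ofReal (radialMollifier ε ξ) * f (Function.update y i ξ) ≤
        f (Function.update y i 0) := by
    by_cases hy : Function.update y i 0 ∈ Metric.closedBall (0 : Hn n) ε
    · rw [f_of_mem hy]
      refine (lintegral_congr fun ξ => ?_).trans_le (h y i hy)
      rcases lt_or_ge ε ‖ξ‖ with hξ | hξ
      · simp [radialMollifier_eq_zero hε hξ]
      · rw [f_of_mem]
        rw [mem_closedBall_zero_iff, pi_norm_le_iff_of_nonneg hε.le] at hy ⊢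
        intro l
        rcases eq_or_ne l i with rfl | hl
        · simpa using hξ
        · simpa [hl] using hy l
    · exact le_top.trans_eq (if_neg hy).symm
  have hw : Measurable fun ξ : Quaternion ℝ => ENNReal.ofReal (radialMollifier ε ξ) :=
    (contDiff_radialMollifier ε).continuous.measurable.ennreal_ofReal
  have iterated := lmarginal_prod_mul_le (fun _ => hw)
    (fun _ => (lintegral_radialMollifier hε).le) 0 Finset.univ hf coordinate_le 0
  rw [← lintegral_eq_lmarginal_univ, ← volume_pi, Finset.piecewise_univ,
    f_of_mem (by simpa using hε.le)] at iterated
  refine (lintegral_congr fun y => ?_).trans_le iterated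
  rw [mollifier, ← ENNReal.ofReal_prod_of_nonneg fun l _ => radialMollifier_nonneg ε (y l)]
  rcases lt_or_ge ε ‖y‖ with hy | hy
  · simp [← mollifier.eq_1, mollifier_eq_zero hε hy]
  · rw [f_of_mem (by simpa using hy)]

end Mollifier

/-- The map `ξ ↦ w ξ` onto the right quaternionic line spanned by `w`. -/
def lineMap (w : Hn n) : Quaternion ℝ →L[ℝ] Hn n :=
  ContinuousLinearMap.pi fun l => ContinuousLinearMap.mul ℝ (Quaternion ℝ) (w l)

lemma lineMap_apply (w : Hn n) (ξ : Quaternion ℝ) (l : Fin n) : lineMap w ξ l = w l * ξ := rfl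

lemma norm_lineMap_le (w : Hn n) (ξ : Quaternion ℝ) : ‖lineMap w ξ‖ ≤ ‖w‖ * ‖ξ‖ := by
  refine (pi_norm_le_iff_of_nonneg (by positivity)).2 fun l => ?_
  rw [lineMap_apply, norm_mul]
  gcongr
  exact norm_le_pi_norm w l

lemma sub_update_eq_add_lineMap (x y : Hn n) (i : Fin n) (ξ : Quaternion ℝ) :
    x - Function.update y i ξ = x - Function.update y i 0 + lineMap (Pi.single i (-1)) ξ := by
  ext1 l
  rcases eq_or_ne l i with rfl | hl
  · simp [lineMap_apply, sub_eq_add_neg]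
  · simp [lineMap_apply, hl]

/-- A function on `ℍⁿ` bounded by `M` that satisfies the mean value inequality on the balls in
right quaternionic lines that are contained in `D`. As in `IsSubharmonicOn`, the inequality is
written for the nonnegative function `M - U`. -/
structure IsSubmean (U : Hn n → ℝ) (D : Set (Hn n)) (M : ℝ) : Prop where
  measurable : Measurable U
  abs_le : ∀ x, |U x| ≤ M
  submean : ∀ x w r, 0 < r → (∀ ξ ∈ Metric.closedBall 0 r, x + lineMap w ξ ∈ D) →
    ∫⁻ ξ in Metric.closedBall 0 r, ENNReal.ofReal (M - U (x + lineMap w ξ)) ≤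
      volume (Metric.closedBall (0 : Quaternion ℝ) r) * ENNReal.ofReal (M - U x)

/-- The convolution of `U` with the product mollifier. -/
def mollify (U : Hn n → ℝ) (ε : ℝ) (x : Hn n) : ℝ := ∫ y, mollifier ε y * U (x - y)

namespace IsSubmean

variable {U : Hn n → ℝ} {D : Set (Hn n)} {M : ℝ}

lemma le_bound (hU : IsSubmean U D M) (x : Hn n) : U x ≤ M := (le_abs_self _).trans (hU.abs_le x)

lemma setIntegral_nonneg (hU : IsSubmean U D M) {x w : Hn n} {r : ℝ} (hr : 0 < r)
    (h : ∀ ξ ∈ Metric.closedBall 0 r, x + lineMap w ξ ∈ D) :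
    0 ≤ ∫ ξ in Metric.closedBall 0 r, (U (x + lineMap w ξ) - U x) := by
  have hfin : volume (Metric.closedBall (0 : Quaternion ℝ) r) ≠ ⊤ := measure_closedBall_lt_top.ne
  have hconst (c : ℝ) : IntegrableOn (fun _ => c) (Metric.closedBall (0 : Quaternion ℝ) r) :=
    integrableOn_const hfin
  have hline : IntegrableOn (fun ξ => U (x + lineMap w ξ)) (Metric.closedBall 0 r) :=
    Measure.integrableOn_of_bounded hfin
      (hU.measurable.comp (by fun_prop)).aestronglyMeasurable (.of_forall fun ξ => hU.abs_le _)
  have mean_le := hU.submean x w r hr h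
  rw [← ofReal_integral_eq_lintegral_ofReal ((hconst M).fun_sub hline)
    (.of_forall fun ξ => sub_nonneg.2 (hU.le_bound _)), ← ENNReal.ofReal_toReal hfin,
    ← ENNReal.ofReal_mul ENNReal.toReal_nonneg, ENNReal.ofReal_le_ofReal_iff
      (mul_nonneg ENNReal.toReal_nonneg (sub_nonneg.2 (hU.le_bound _))),
    integral_sub (hconst M) hline] at mean_le
  rw [integral_sub hline (hconst _)]
  simp only [setIntegral_const, smul_eq_mul, Measure.real] at mean_le ⊢
  linarith

variable {ε : ℝ}

lemma integrable_mollifier_mul (hU : IsSubmean U D M) (hε : 0 < ε) (x : Hn n) :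
    Integrable fun y => mollifier ε y * U (x - y) :=
  (integrable_mollifier hε).mul_bdd (c := M)
    (hU.measurable.comp (by fun_prop)).aestronglyMeasurable (.of_forall fun _ => hU.abs_le _)

lemma contDiff_mollify (hU : IsSubmean U D M) (hε : 0 < ε) : ContDiff ℝ ∞ (mollify U ε) :=
  (hasCompactSupport_mollifier hε).contDiff_convolution_left (ContinuousLinearMap.lsmul ℝ ℝ)
    (contDiff_mollifier ε) ((locallyIntegrable_const M).mono
      hU.measurable.aestronglyMeasurable (.of_forall fun x => (hU.abs_le x).trans (le_abs_self M)))

lemma mollify_le (hU : IsSubmean U D M) {c : ℝ} (hε : 0 < ε) {x : Hn n}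
    (h : ∀ y ∈ Metric.closedBall x ε, U y ≤ c) : mollify U ε x ≤ c := by
  have hc : ∫ y : Hn n, mollifier ε y * c = c := by
    rw [integral_mul_const, integral_mollifier hε, one_mul]
  rw [← hc]
  refine integral_mono (hU.integrable_mollifier_mul hε x)
    ((integrable_mollifier hε).mul_const c) fun y => ?_
  rcases lt_or_ge ε ‖y‖ with hy | hy
  · simp [mollifier_eq_zero hε hy]
  · exact mul_le_mul_of_nonneg_left (h _ (by simpa [dist_eq_norm] using hy)) (mollifier_nonneg ε y)

lemma abs_mollify_le (hU : IsSubmean U D M) (hε : 0 < ε) (x : Hn n) : |mollify U ε x| ≤ M := by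
  have h : |mollify U ε x| ≤ ∫ y : Hn n, mollifier ε y * M := by
    refine norm_integral_le_of_norm_le (f := fun y => mollifier ε y * U (x - y))
      ((integrable_mollifier hε).mul_const M) (.of_forall fun y => ?_)
    rw [norm_mul, Real.norm_of_nonneg (mollifier_nonneg ε y)]
    exact mul_le_mul_of_nonneg_left (hU.abs_le _) (mollifier_nonneg ε y)
  rwa [integral_mul_const, integral_mollifier hε, one_mul] at h

lemma lintegral_mollifier_mul_le (hU : IsSubmean U D M) (hε : 0 < ε) {x : Hn n}
    (hx : Metric.closedBall x ε ⊆ D) :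
    ∫⁻ y, ENNReal.ofReal (mollifier ε y) * ENNReal.ofReal (M - U (x - y)) ≤
      ENNReal.ofReal (M - U x) := by
  have hF : Measurable fun y => ENNReal.ofReal (M - U (x - y)) :=
    (measurable_const.sub (hU.measurable.comp (by fun_prop))).ennreal_ofReal
  refine (QuatPluripotential.lintegral_mollifier_mul_le hε hF fun y i hy => ?_).trans_eq
    (by rw [sub_zero])
  rw [← one_mul (ENNReal.ofReal _), ← lintegral_radialMollifier (E := Quaternion ℝ) hε]
  refine lintegral_radial_mul_le (ε := ε) (hF.comp (measurable_update y))
    (contDiff_radialMollifier ε).continuous (radialMollifier_nonneg ε)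
    (fun _ _ => radialMollifier_anti ε) (fun _ => radialMollifier_eq_zero hε) fun r hr hrε => ?_
  suffices h : ∀ ξ ∈ Metric.closedBall 0 r, x - Function.update y i ξ ∈ D by
    simpa only [← sub_update_eq_add_lineMap, Function.comp_apply] using
      hU.submean (x - Function.update y i 0) (Pi.single i (-1)) r hr fun ξ hξ =>
        sub_update_eq_add_lineMap x y i ξ ▸ h ξ hξ
  refine fun ξ hξ => hx ?_
  rw [mem_closedBall_iff_norm, sub_sub_cancel_left, norm_neg,
    pi_norm_le_iff_of_nonneg hε.le]
  rw [mem_closedBall_zero_iff, pi_norm_le_iff_of_nonneg hε.le] at hy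
  intro l
  rcases eq_or_ne l i with rfl | hl
  · simpa using (mem_closedBall_zero_iff.1 hξ).trans hrε
  · simpa [hl] using hy l

lemma le_mollify (hU : IsSubmean U D M) (hε : 0 < ε) {x : Hn n}
    (hx : Metric.closedBall x ε ⊆ D) : U x ≤ mollify U ε x := by
  have hM := (integrable_mollifier (n := n) hε).mul_const M
  have hUx := hU.integrable_mollifier_mul hε x
  have hval : ∫ y, mollifier ε y * (M - U (x - y)) = M - mollify U ε x := by
    simp only [mul_sub]
    rw [integral_sub hM hUx, integral_mul_const, integral_mollifier hε, one_mul, mollify]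
  have mean_le := hU.lintegral_mollifier_mul_le hε hx
  simp only [← ENNReal.ofReal_mul (mollifier_nonneg ε _)] at mean_le
  have hint : Integrable fun y => mollifier ε y * (M - U (x - y)) := by
    simp only [mul_sub]
    exact hM.sub hUx
  rw [← ofReal_integral_eq_lintegral_ofReal hint
    (.of_forall fun y => mul_nonneg (mollifier_nonneg ε y) (sub_nonneg.2 (hU.le_bound _))),
    hval, ENNReal.ofReal_le_ofReal_iff (sub_nonneg.2 (hU.le_bound _))] at mean_le
  linarith

lemma integrable_mollifier_mul_line (hU : IsSubmean U D M) (hε : 0 < ε) (x w : Hn n) (r : ℝ) :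
    Integrable
      (fun z : Quaternion ℝ × Hn n =>
        mollifier ε z.2 * (U (x - z.2 + lineMap w z.1) - U (x - z.2)))
      ((volume.restrict (Metric.closedBall 0 r)).prod volume) := by
  have : IsFiniteMeasure (volume.restrict (Metric.closedBall (0 : Quaternion ℝ) r)) :=
    isFiniteMeasure_restrict.2 measure_closedBall_lt_top.ne
  have hweight : Integrable (fun z : Quaternion ℝ × Hn n => mollifier ε z.2)
      ((volume.restrict (Metric.closedBall 0 r)).prod volume) := by
    simpa only [one_mul] using (integrable_const (1 : ℝ)).mul_prod (integrable_mollifier hε)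
  refine hweight.mul_bdd (c := M + M) ?_ (.of_forall fun z => ?_)
  · exact ((hU.measurable.comp (by fun_prop)).sub
      (hU.measurable.comp (by fun_prop))).aestronglyMeasurable
  · exact (norm_sub_le _ _).trans (add_le_add (hU.abs_le _) (hU.abs_le _))

lemma setIntegral_mollify_nonneg (hU : IsSubmean U D M) {δ : ℝ} (hε : 0 < ε) {x w : Hn n} {r : ℝ}
    (hr : 0 < r) (hx : Metric.closedBall x (ε + δ) ⊆ D) (hw : ‖w‖ * r ≤ δ) :
    0 ≤ ∫ ξ in Metric.closedBall 0 r, (mollify U ε (x + lineMap w ξ) - mollify U ε x) := by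
  have hdiff (ξ : Quaternion ℝ) : mollify U ε (x + lineMap w ξ) - mollify U ε x =
      ∫ y, mollifier ε y * (U (x - y + lineMap w ξ) - U (x - y)) := by
    rw [mollify, mollify, ← integral_sub (hU.integrable_mollifier_mul hε _)
      (hU.integrable_mollifier_mul hε _)]
    simp only [mul_sub, sub_add_eq_add_sub]
  simp only [hdiff]
  rw [integral_integral_swap (hU.integrable_mollifier_mul_line hε x w r)]
  refine integral_nonneg fun y => ?_
  simp only [integral_const_mul]
  rcases lt_or_ge ε ‖y‖ with hy | hy
  · simp [mollifier_eq_zero hε hy]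
  refine mul_nonneg (mollifier_nonneg ε y) (hU.setIntegral_nonneg hr fun ξ hξ => hx ?_)
  rw [mem_closedBall_iff_norm]
  calc ‖x - y + lineMap w ξ - x‖ = ‖-y + lineMap w ξ‖ := by congr 1; abel
    _ ≤ ‖y‖ + ‖w‖ * ‖ξ‖ := by
      grw [norm_add_le, norm_neg, norm_lineMap_le]
    _ ≤ ε + ‖w‖ * r := by
      gcongr
      exact mem_closedBall_zero_iff.1 hξ
    _ ≤ ε + δ := by gcongr

end IsSubmean

/-! ### The mean value inequality and the Hessian -/

lemma norm_quatBasis (e : Fin 4) : ‖quatBasis e‖ = 1 := by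
  have h : ‖quatBasis e‖ * ‖quatBasis e‖ = 1 := by
    rw [← Quaternion.normSq_eq_norm_mul_self, Quaternion.normSq_def']
    fin_cases e <;> simp [quatBasis]
  nlinarith [norm_nonneg (quatBasis e)]

lemma sum_smul_quatBasis (ξ : Quaternion ℝ) :
    ∑ a, ![ξ.re, ξ.imI, ξ.imJ, ξ.imK] a • quatBasis a = ξ := by
  ext <;> simp [Fin.sum_univ_four, re_quatBasis, imI_quatBasis, imJ_quatBasis, imK_quatBasis]

/-- The `ξ * quatBasis e` form an orthogonal basis of vectors of norm `‖ξ‖`, and traces do not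
depend on the orthonormal basis. -/
lemma sum_bilin_mul_quatBasis (b : LinearMap.BilinForm ℝ (Quaternion ℝ)) (ξ : Quaternion ℝ) :
    ∑ e, b (ξ * quatBasis e) (ξ * quatBasis e) = ‖ξ‖ ^ 2 * ∑ e, b (quatBasis e) (quatBasis e) := by
  have hcoord (p q : Quaternion ℝ) : b p q = ∑ a, ∑ c, ![p.re, p.imI, p.imJ, p.imK] a *
      (![q.re, q.imI, q.imJ, q.imK] c * b (quatBasis a) (quatBasis c)) := by
    conv_lhs => rw [← sum_smul_quatBasis p, ← sum_smul_quatBasis q]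
    simp only [map_sum, map_smul, LinearMap.sum_apply, LinearMap.smul_apply, smul_eq_mul,
      Finset.mul_sum]
    rw [Finset.sum_comm]
    simp only [mul_left_comm]
  rw [sq, ← Quaternion.normSq_eq_norm_mul_self, Quaternion.normSq_def']
  generalize hβ : (fun a c => b (quatBasis a) (quatBasis c)) = β
  have hβ' (a c) : b (quatBasis a) (quatBasis c) = β a c := by rw [← hβ]
  simp only [hcoord (ξ * _), hβ', Fin.sum_univ_four]
  simp [re_quatBasis, imI_quatBasis, imJ_quatBasis, imK_quatBasis]
  ring

/-- Right multiplication by a quaternion of norm one, as an isometry. -/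
def rightMulIsometry (e : Quaternion ℝ) (he : ‖e‖ = 1) : Quaternion ℝ ≃ₗᵢ[ℝ] Quaternion ℝ where
  toFun ξ := ξ * e
  invFun ξ := ξ * star e
  map_add' ξ ζ := add_mul ξ ζ e
  map_smul' c ξ := smul_mul_assoc c ξ e
  left_inv ξ := by
    change ξ * e * star e = ξ
    rw [mul_assoc, Quaternion.self_mul_star, Quaternion.normSq_eq_norm_mul_self, he, mul_one,
      Quaternion.coe_one, mul_one]
  right_inv ξ := by
    change ξ * star e * e = ξ
    rw [mul_assoc, Quaternion.star_mul_self, Quaternion.normSq_eq_norm_mul_self, he, mul_one,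
      Quaternion.coe_one, mul_one]
  norm_map' ξ := by simp [he]

lemma setIntegral_closedBall_comp_linearIsometryEquiv {E F : Type*} [NormedAddCommGroup E]
    [InnerProductSpace ℝ E] [FiniteDimensional ℝ E] [MeasurableSpace E] [BorelSpace E]
    [NormedAddCommGroup F] [NormedSpace ℝ F] (L : E ≃ₗᵢ[ℝ] E) (f : E → F) (r : ℝ) :
    ∫ x in Metric.closedBall 0 r, f (L x) = ∫ x in Metric.closedBall 0 r, f x := by
  have h := L.measurePreserving.setIntegral_preimage_emb
    L.toMeasurableEquiv.measurableEmbedding f (Metric.closedBall 0 r)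
  rwa [L.preimage_closedBall, map_zero] at h

lemma integrableOn_closedBall {E F : Type*} [NormedAddCommGroup E] [ProperSpace E]
    [MeasureSpace E] [BorelSpace E] [IsFiniteMeasureOnCompacts (volume : Measure E)]
    [NormedAddCommGroup F] {f : E → F} (hf : Continuous f) (x : E) (r : ℝ) :
    IntegrableOn f (Metric.closedBall x r) :=
  hf.continuousOn.integrableOn_compact (isCompact_closedBall _ _)

lemma setIntegral_closedBall_clm {E : Type*} [NormedAddCommGroup E]
    [InnerProductSpace ℝ E] [FiniteDimensional ℝ E] [MeasurableSpace E] [BorelSpace E]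
    (L : E →L[ℝ] ℝ) (r : ℝ) : ∫ x in Metric.closedBall 0 r, L x = 0 := by
  have h := setIntegral_closedBall_comp_linearIsometryEquiv (LinearIsometryEquiv.neg ℝ) (⇑L) r
  simp only [LinearIsometryEquiv.coe_neg, map_neg, integral_neg] at h
  linarith

lemma continuous_bilinForm_self {E : Type*} [NormedAddCommGroup E] [NormedSpace ℝ E]
    [FiniteDimensional ℝ E] (b : LinearMap.BilinForm ℝ E) : Continuous fun x => b x x :=
  (LinearMap.toContinuousBilinearMap b).continuous₂.comp (continuous_id.prodMk continuous_id)

lemma setIntegral_closedBall_bilin (b : LinearMap.BilinForm ℝ (Quaternion ℝ)) (r : ℝ) :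
    4 * ∫ ξ in Metric.closedBall 0 r, b ξ ξ =
      (∑ e, b (quatBasis e) (quatBasis e)) * ∫ ξ in Metric.closedBall (0 : Quaternion ℝ) r,
        ‖ξ‖ ^ 2 := by
  have hb : Continuous fun ξ => b ξ ξ := continuous_bilinForm_self b
  have hinv (e : Fin 4) : ∫ ξ in Metric.closedBall 0 r, b (ξ * quatBasis e) (ξ * quatBasis e) =
      ∫ ξ in Metric.closedBall 0 r, b ξ ξ :=
    setIntegral_closedBall_comp_linearIsometryEquiv
      (rightMulIsometry (quatBasis e) (norm_quatBasis e)) (fun ξ => b ξ ξ) r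
  calc 4 * ∫ ξ in Metric.closedBall 0 r, b ξ ξ
      = ∑ e, ∫ ξ in Metric.closedBall 0 r, b (ξ * quatBasis e) (ξ * quatBasis e) := by
        simp [hinv]
    _ = ∫ ξ in Metric.closedBall 0 r, ∑ e, b (ξ * quatBasis e) (ξ * quatBasis e) :=
        (integral_finsetSum _ fun e _ =>
          integrableOn_closedBall (hb.comp (continuous_mul_const _)) 0 r).symm
    _ = _ := by
        simp only [sum_bilin_mul_quatBasis, mul_comm (‖_‖ ^ 2), integral_const_mul]

section Taylor

variable {E F : Type*} [NormedAddCommGroup E] [NormedSpace ℝ E] [NormedAddCommGroup F]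
  [NormedSpace ℝ F]

lemma hessian_comp_const_add_clm {v : F → ℝ} (hv : ContDiff ℝ 2 v) (x : F) (L : E →L[ℝ] F) (ξ : E) :
    hessian (fun ζ => v (x + L ζ)) ξ = (hessian v (x + L ξ)).comp L L := by
  have hL (ζ : E) : HasFDerivAt (fun ζ => x + L ζ) L ζ := L.hasFDerivAt.const_add x
  have hfderiv : fderiv ℝ (fun ζ => v (x + L ζ)) = fun ζ => (fderiv ℝ v (x + L ζ)).comp L :=
    funext fun ζ => ((hv.differentiable (by simp) _).hasFDerivAt.comp ζ (hL ζ)).fderiv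
  have hd : DifferentiableAt ℝ (fderiv ℝ v) (x + L ξ) :=
    (hv.fderiv_right (m := 1) le_rfl).differentiable (by simp) _
  ext p q
  simp only [hessian, hfderiv]
  exact DFunLike.congr_fun (DFunLike.congr_fun
    (((ContinuousLinearMap.compL ℝ E F ℝ).flip L).hasFDerivAt.comp ξ
      (hd.hasFDerivAt.comp ξ (hL ξ))).fderiv p) q

open Asymptotics Topology in
lemma isLittleO_taylor_two {v : E → ℝ} (hv : ContDiff ℝ 2 v) (x : E) :
    (fun h => v (x + h) - v x - fderiv ℝ v x h - hessian v x h h / 2) =o[𝓝 0]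
      fun h => ‖h‖ ^ 2 := by
  have hd : DifferentiableAt ℝ (fderiv ℝ v) x :=
    (hv.fderiv_right (m := 1) le_rfl).differentiable (by simp) x
  have hderiv (h : E) : HasFDerivAt
      (fun h => v (x + h) - fderiv ℝ v x h - hessian v x h h / 2)
      (fderiv ℝ v (x + h) - fderiv ℝ v x - fderiv ℝ (fderiv ℝ v) x h) h := by
    have hq : HasFDerivAt (fun h => hessian v x h h)
        ((2 : ℝ) • fderiv ℝ (fderiv ℝ v) x h) h := by
      refine ((fderiv ℝ (fderiv ℝ v) x).hasFDerivAt.clm_apply (hasFDerivAt_id h)).congr_fderiv ?_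
      ext k
      have hsymm : fderiv ℝ (fderiv ℝ v) x k h = fderiv ℝ (fderiv ℝ v) x h k :=
        (isSymm_hessian hv x).eq k h
      simp [hsymm, two_mul]
    refine ((((hv.differentiable (by simp) _).hasFDerivAt.comp h
      ((hasFDerivAt_id h).const_add x)).sub (fderiv ℝ v x).hasFDerivAt).sub
      (hq.mul_const (2⁻¹ : ℝ))).congr_fderiv ?_
    ext k
    simp
  have ho := convex_univ.isLittleO_pow_succ (n := 1) (Set.mem_univ (0 : E))
    (fun h _ => (hderiv h).hasFDerivWithinAt) (by
      simpa using (hasFDerivAt_iff_isLittleO_nhds_zero.1 hd.hasFDerivAt).norm_right)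
  simpa [nhdsWithin_univ, sub_right_comm] using ho

end Taylor

lemma setIntegral_closedBall_norm_sq_pos {r : ℝ} (hr : 0 < r) :
    0 < ∫ ξ in Metric.closedBall (0 : Quaternion ℝ) r, ‖ξ‖ ^ 2 := by
  rw [setIntegral_pos_iff_support_of_nonneg_ae (.of_forall fun _ => sq_nonneg _)
    (integrableOn_closedBall (by fun_prop) 0 r)]
  have hsupp : Function.support (fun ξ : Quaternion ℝ => ‖ξ‖ ^ 2) = {0}ᶜ := by
    ext ξ
    simp
  rw [hsupp, Set.inter_comm, ← Set.sdiff_eq, measure_sdiff_null (measure_singleton _)]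
  exact Metric.measure_closedBall_pos _ _ hr

/-- The odd part of the Taylor expansion does not contribute to the mean over a ball. -/
lemma trace_hessian_nonneg_of_submean {f : Quaternion ℝ → ℝ} (hf : ContDiff ℝ 2 f) {r₀ : ℝ}
    (hr₀ : 0 < r₀)
    (h : ∀ r, 0 < r → r ≤ r₀ → 0 ≤ ∫ ξ in Metric.closedBall 0 r, (f ξ - f 0)) :
    0 ≤ ∑ e, hessian f 0 (quatBasis e) (quatBasis e) := by
  by_contra! htrace
  set c := ∑ e, hessian f 0 (quatBasis e) (quatBasis e)
  have htaylor := (isLittleO_taylor_two hf 0).bound (show 0 < -c / 16 by linarith)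
  obtain ⟨δ, hδ, hball⟩ := Metric.eventually_nhds_iff_ball.1 htaylor
  set r := min r₀ (δ / 2)
  have hr : 0 < r := lt_min hr₀ (half_pos hδ)
  have hle (ξ : Quaternion ℝ) (hξ : ξ ∈ Metric.closedBall 0 r) :
      f ξ - f 0 ≤ fderiv ℝ f 0 ξ + hessian f 0 ξ ξ / 2 + -c / 16 * ‖ξ‖ ^ 2 := by
    have hbound := (le_abs_self _).trans (hball ξ <| Metric.closedBall_subset_ball
      ((min_le_right _ _).trans_lt (half_lt_self hδ)) hξ)
    rw [zero_add, norm_pow, norm_norm] at hbound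
    linarith
  have hint {g : Quaternion ℝ → ℝ} (hg : Continuous g) :
      Integrable g (volume.restrict (Metric.closedBall 0 r)) := integrableOn_closedBall hg 0 r
  have hf' : Continuous f := hf.continuous
  have hhess : Continuous fun ξ => hessian f 0 ξ ξ := continuous_bilinForm_self _
  have hmean : ∫ ξ in Metric.closedBall 0 r, (f ξ - f 0) ≤ ∫ ξ in Metric.closedBall 0 r,
      (fderiv ℝ f 0 ξ + hessian f 0 ξ ξ / 2 + -c / 16 * ‖ξ‖ ^ 2) :=
    setIntegral_mono_on (hint (by fun_prop)) (hint (by fun_prop)) measurableSet_closedBall hle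
  rw [integral_add (hint (by fun_prop)) (hint (by fun_prop)),
    integral_add (hint (by fun_prop)) (hint (by fun_prop)), setIntegral_closedBall_clm,
    integral_div, integral_const_mul] at hmean
  have htr := setIntegral_closedBall_bilin (hessian f 0) r
  nlinarith [h r hr (min_le_left _ _), setIntegral_closedBall_norm_sq_pos hr]

theorem trace_hessian_rightMul_nonneg {v : Hn n → ℝ} (hv : ContDiff ℝ 2 v) (x w : Hn n) {r₀ : ℝ}
    (hr₀ : 0 < r₀) (h : ∀ r, 0 < r → r ≤ r₀ →
      0 ≤ ∫ ξ in Metric.closedBall 0 r, (v (x + lineMap w ξ) - v x)) :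
    0 ≤ ∑ e, hessian v x (rightMul (quatBasis e) w) (rightMul (quatBasis e) w) := by
  have hf : ContDiff ℝ 2 fun ξ => v (x + lineMap w ξ) :=
    hv.comp (contDiff_const.add (lineMap w).contDiff)
  simpa [hessian_comp_const_add_clm hv] using!
    trace_hessian_nonneg_of_submean hf hr₀ (by simpa using h)

/-! ### Regularization of plurisubharmonic functions -/

lemma IsLocallyBounded.exists_bound {u : Hn n → EReal} (hu : IsLocallyBounded Ω u) {D : Set (Hn n)}
    (hD : IsCompact D) (hDΩ : D ⊆ Ω) :
    ∃ M : ℝ, 0 ≤ M ∧ ∀ x ∈ D, u x ∈ Set.Icc ((-M : ℝ) : EReal) M := by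
  have hmono {M N : ℝ} (h : M ≤ N) :
      Set.Icc ((-M : ℝ) : EReal) M ⊆ Set.Icc ((-N : ℝ) : EReal) N :=
    Set.Icc_subset_Icc (EReal.coe_le_coe_iff.2 (neg_le_neg h)) (EReal.coe_le_coe_iff.2 h)
  refine hD.induction_on (p := fun s => ∃ M : ℝ, 0 ≤ M ∧ ∀ x ∈ s,
      u x ∈ Set.Icc ((-M : ℝ) : EReal) M)
    ⟨0, le_rfl, by simp⟩ (fun s t hst ⟨M, hM₀, hM⟩ => ⟨M, hM₀, fun x hx => hM x (hst hx)⟩) ?_ ?_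
  · rintro s t ⟨M, hM₀, hM⟩ ⟨N, -, hN⟩
    exact ⟨max M N, hM₀.trans (le_max_left _ _), fun x hx =>
      hx.elim (fun h => hmono (le_max_left _ _) (hM x h))
        fun h => hmono (le_max_right _ _) (hN x h)⟩
  · intro x hx
    obtain ⟨M, hM⟩ := hu x (hDΩ hx)
    exact ⟨_, mem_nhdsWithin_of_mem_nhds hM, max M 0, le_max_right _ _,
      fun y hy => hmono (le_max_left _ _) hy⟩

lemma coe_toReal_of_mem_Icc {t : EReal} {a b : ℝ} (h : t ∈ Set.Icc (a : EReal) b) :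
    (t.toReal : EReal) = t :=
  EReal.coe_toReal (ne_top_of_le_ne_top (EReal.coe_ne_top _) h.2)
    (ne_bot_of_le_ne_bot (EReal.coe_ne_bot _) h.1)

lemma abs_toReal_le {t : EReal} {M : ℝ} (h : t ∈ Set.Icc ((-M : ℝ) : EReal) M) :
    |t.toReal| ≤ M := by
  rw [← coe_toReal_of_mem_Icc h] at h
  exact abs_le.2 ⟨EReal.coe_le_coe_iff.1 h.1, EReal.coe_le_coe_iff.1 h.2⟩

lemma measurable_indicator_toReal {X : Type*} [TopologicalSpace X] [MeasurableSpace X]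
    [BorelSpace X] {u : X → EReal} {D : Set X} (hu : UpperSemicontinuousOn u D) (hD : IsClosed D) :
    Measurable (D.indicator fun x => (u x).toReal) := by
  classical
  have husc : UpperSemicontinuous fun x => if x ∈ D then u x else ⊥ := by
    intro x c hc
    by_cases hx : x ∈ D
    · simp only [if_pos hx] at hc ⊢
      filter_upwards [eventually_nhdsWithin_iff.1 (hu x hx c hc)] with y hy
      split_ifs with hyD
      exacts [hy hyD, bot_le.trans_lt hc]
    · simp only [if_neg hx] at hc ⊢
      filter_upwards [hD.isOpen_compl.mem_nhds hx] with y hy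
      rwa [if_neg hy]
  convert husc.measurable.ereal_toReal using 1
  ext x
  by_cases hx : x ∈ D <;> simp [hx]

lemma upperSemicontinuousAt_indicator_toReal {X : Type*} [TopologicalSpace X] {u : X → EReal}
    {D : Set X} {M : ℝ} (hM : ∀ x ∈ D, u x ∈ Set.Icc ((-M : ℝ) : EReal) M) {x : X}
    (hD : D ∈ nhds x) (hu : UpperSemicontinuousAt u x) :
    UpperSemicontinuousAt (D.indicator fun x => (u x).toReal) x := by
  have hlt (y : X) (hy : y ∈ D) (c : ℝ) :
      D.indicator (fun x => (u x).toReal) y < c ↔ u y < c := by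
    rw [Set.indicator_of_mem hy, ← EReal.coe_lt_coe_iff, coe_toReal_of_mem_Icc (hM y hy)]
  intro c hc
  filter_upwards [hD, hu c ((hlt x (mem_of_mem_nhds hD) c).1 hc)] with y hyD hy
  exact (hlt y hyD c).2 hy

lemma IsPSH.isSubmean {u : Hn n → EReal} (hu : IsPSH Ω u) {D : Set (Hn n)} (hD : IsClosed D)
    (hDΩ : D ⊆ Ω) {M : ℝ} (hM₀ : 0 ≤ M) (hM : ∀ x ∈ D, u x ∈ Set.Icc ((-M : ℝ) : EReal) M) :
    IsSubmean (D.indicator fun x => (u x).toReal) D M where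
  measurable := measurable_indicator_toReal (hu.1.mono hDΩ) hD
  abs_le x := by
    by_cases hx : x ∈ D
    · rw [Set.indicator_of_mem hx]
      exact abs_toReal_le (hM x hx)
    · rwa [Set.indicator_of_notMem hx, abs_zero]
  submean x w r hr hxw := by
    have hval (y : Hn n) (hy : y ∈ D) :
        ENNReal.ofReal (M - D.indicator (fun x => (u x).toReal) y) =
          ((M : EReal) - u y).toENNReal := by
      rw [Set.indicator_of_mem hy, ← EReal.real_coe_toENNReal, EReal.coe_sub,
        coe_toReal_of_mem_Icc (hM y hy)]
    have hxD : x ∈ D := by simpa using hxw 0 (by simp [hr.le])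
    rcases eq_or_ne w 0 with rfl | hw
    · have hline (ξ : Quaternion ℝ) : lineMap (0 : Hn n) ξ = 0 := funext fun _ => zero_mul ξ
      simp only [hline, add_zero, setLIntegral_const, mul_comm, le_refl]
    · rw [setLIntegral_congr_fun measurableSet_closedBall fun ξ hξ => hval _ (hxw ξ hξ), hval x hxD]
      simpa using! (hu.2.2 x w hw).2.2 0 r hr (fun ξ hξ => hDΩ (hxw ξ hξ)) M
        fun ξ hξ => (hM _ (hxw ξ hξ)).2

lemma IsSubmean.tendsto_mollify {U : Hn n → ℝ} {D : Set (Hn n)} {M : ℝ} (hU : IsSubmean U D M)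
    {x : Hn n} (hD : D ∈ nhds x) (husc : UpperSemicontinuousAt U x) :
    Tendsto (fun ε => mollify U ε x) (nhdsWithin 0 (Set.Ioi 0)) (nhds (U x)) := by
  have hsmall {s : Set (Hn n)} (hs : s ∈ nhds x) :
      ∀ᶠ ε in nhdsWithin (0 : ℝ) (Set.Ioi 0), 0 < ε ∧ Metric.closedBall x ε ⊆ s := by
    obtain ⟨r, hr, hball⟩ := Metric.nhds_basis_closedBall.mem_iff.1 hs
    filter_upwards [Ioc_mem_nhdsGT hr] with ε hε
    exact ⟨hε.1, (Metric.closedBall_subset_closedBall hε.2).trans hball⟩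
  refine tendsto_order.2 ⟨fun c hc => ?_, fun c hc => ?_⟩
  · filter_upwards [hsmall hD] with ε hε
    exact hc.trans_le (hU.le_mollify hε.1 hε.2)
  · obtain ⟨c', hc', hcc'⟩ := exists_between hc
    filter_upwards [hsmall (husc c' hc')] with ε hε
    exact (hU.mollify_le hε.1 fun y hy => (hε.2 hy).le).trans_lt hcc'

lemma IsSubmean.trace_hessian_mollify_nonneg {U : Hn n → ℝ} {D : Set (Hn n)} {M : ℝ}
    (hU : IsSubmean U D M) {ε δ : ℝ} (hε : 0 < ε) (hεδ : ε < δ) {x : Hn n}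
    (hx : Metric.closedBall x δ ⊆ D) (w : Hn n) :
    0 ≤ ∑ e, hessian (mollify U ε) x (rightMul (quatBasis e) w) (rightMul (quatBasis e) w) := by
  have hw : 0 < ‖w‖ + 1 := by positivity
  refine trace_hessian_rightMul_nonneg ((hU.contDiff_mollify hε).of_le ENat.LEInfty.out) x w
    (r₀ := (δ - ε) / (‖w‖ + 1)) (div_pos (sub_pos.2 hεδ) hw) fun r hr hr₀ => ?_
  refine hU.setIntegral_mollify_nonneg (δ := δ - ε) hε hr (by rwa [add_sub_cancel]) ?_
  rw [le_div_iff₀ hw] at hr₀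
  linarith

theorem IsPSH.exists_smooth_approx {u : Hn n → EReal} (hu : IsPSH Ω u) (hlb : IsLocallyBounded Ω u)
    {K : Set (Hn n)} (hK : IsCompact K) (hKΩ : K ⊆ Ω) :
    ∃ (v : ℕ → Hn n → ℝ) (M : ℝ), (∀ i, ContDiff ℝ ∞ (v i)) ∧ (∀ i x, |v i x| ≤ M) ∧
      (∀ x ∈ K, Tendsto (fun i => v i x) atTop (nhds (u x).toReal)) ∧
      ∀ i, ∀ x ∈ K, ∀ w, 0 ≤ ∑ e, hessian (v i) x
        (rightMul (quatBasis e) w) (rightMul (quatBasis e) w) := by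
  obtain ⟨δ, hδ, hδΩ⟩ := hK.exists_cthickening_subset_open Ω.isOpen hKΩ
  set D := Metric.cthickening δ K
  obtain ⟨M, hM₀, hM⟩ := hlb.exists_bound hK.cthickening hδΩ
  have hU := hu.isSubmean Metric.isClosed_cthickening hδΩ hM₀ hM
  set U := D.indicator fun x => (u x).toReal with hUdef
  have hball (x) (hx : x ∈ K) : Metric.closedBall x δ ⊆ D :=
    Metric.closedBall_subset_cthickening hx δ
  obtain ⟨ε, -, hε, hεlim⟩ := exists_seq_strictAnti_tendsto' hδ
  refine ⟨fun i => mollify U (ε i), M, fun i => hU.contDiff_mollify (hε i).1,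
    fun i => hU.abs_mollify_le (hε i).1, fun x hx => ?_, fun i x hx =>
      hU.trace_hessian_mollify_nonneg (hε i).1 (hε i).2 (hball x hx)⟩
  have hDx : D ∈ nhds x := mem_of_superset (Metric.closedBall_mem_nhds x hδ) (hball x hx)
  have husc : UpperSemicontinuousAt u x :=
    fun c hc => Ω.isOpen.nhdsWithin_eq (hKΩ hx) ▸ hu.1 x (hKΩ hx) c hc
  have hlim := (hU.tendsto_mollify hDx (upperSemicontinuousAt_indicator_toReal hM hDx husc)).comp
    (tendsto_nhdsWithin_iff.2 ⟨hεlim, .of_forall fun i => (hε i).1⟩)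
  rwa [hUdef, Set.indicator_of_mem (mem_of_mem_nhds hDx)] at hlim

/-! ### Positive functionals on test functions -/

section TestFunction

variable {E : Type*} [NormedAddCommGroup E] [NormedSpace ℝ E] {U : TopologicalSpace.Opens E}

lemma testFunction_eq_zero_of_notMem {F : Type*} [NormedAddCommGroup F] [NormedSpace ℝ F]
    (φ : 𝓓(U, F)) {x : E} (hx : x ∉ U) : φ x = 0 :=
  image_eq_zero_of_notMem_tsupport fun h => hx (φ.tsupport_subset h)

lemma exists_testFunction_eq_one [FiniteDimensional ℝ E] {K : Set E} (hK : IsCompact K)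
    (hKU : K ⊆ U) : ∃ φ : 𝓓(U, ℝ), (∀ x, 0 ≤ φ x) ∧ ∀ x ∈ K, φ x = 1 := by
  obtain ⟨L, hL, hKL, hLU⟩ := exists_compact_between hK U.isOpen hKU
  obtain ⟨f, hf_zero, hf_one, hf_mem⟩ := exists_contMDiffMap_zero_one_of_isClosed (n := (⊤ : ℕ∞))
    (modelWithCornersSelf ℝ E) isOpen_interior.isClosed_compl hK.isClosed
    (Set.disjoint_compl_left_iff_subset.2 hKL)
  have hfL : tsupport f ⊆ L := closure_minimal
    (fun x hx => interior_subset <| Set.not_notMem.1 fun h => hx (hf_zero h)) hL.isClosed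
  exact ⟨⟨f, f.contMDiff.contDiff, hL.of_isClosed_subset (isClosed_tsupport f) hfL,
    hfL.trans hLU⟩, fun x => (hf_mem x).1, fun x hx => hf_one hx⟩

lemma exists_testFunction_ge [FiniteDimensional ℝ E] {K : Set E} (hK : IsCompact K)
    (hKU : K ⊆ U) (C : ℝ) : ∃ φ : 𝓓(U, ℝ), (∀ x, 0 ≤ φ x) ∧ ∀ x ∈ K, C ≤ φ x := by
  obtain ⟨χ, hχ_nonneg, hχ_one⟩ := exists_testFunction_eq_one hK hKU
  refine ⟨|C| • χ, fun x => mul_nonneg (abs_nonneg C) (hχ_nonneg x), fun x hx => ?_⟩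
  change C ≤ |C| * χ x
  rw [hχ_one x hx, mul_one]
  exact le_abs_self C

/-- The restriction of a test function on `U` to a compactly supported function on the subtype `U`,
the locally compact space on which the Riesz representation theorem is applied. -/
def restrictTest : 𝓓(U, ℝ) →ₗ[ℝ] C_c(U, ℝ) where
  toFun φ :=
    { toFun := fun x => φ x
      continuous_toFun := φ.continuous.comp continuous_subtype_val
      hasCompactSupport' := by
        have h : IsCompact ((Subtype.val : U → E) ⁻¹' tsupport φ) :=
          Topology.IsEmbedding.subtypeVal.isInducing.isCompact_preimage' φ.hasCompactSupport
            (Subtype.range_coe.symm ▸ φ.tsupport_subset)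
        exact HasCompactSupport.of_support_subset_isCompact h fun x hx => subset_closure hx }
  map_add' _ _ := rfl
  map_smul' _ _ := rfl

lemma restrictTest_injective : Function.Injective (restrictTest (U := U)) := by
  intro φ ψ h
  ext x
  by_cases hx : x ∈ U
  · exact DFunLike.congr_fun h (⟨x, hx⟩ : U)
  · rw [testFunction_eq_zero_of_notMem φ hx, testFunction_eq_zero_of_notMem ψ hx]

lemma nonneg_of_restrictTest_nonneg {φ : 𝓓(U, ℝ)} (hφ : ∀ x, 0 ≤ restrictTest φ x) (x : E) :
    0 ≤ φ x := by
  by_cases hx : x ∈ U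
  · exact hφ (⟨x, hx⟩ : U)
  · rw [testFunction_eq_zero_of_notMem φ hx]

lemma exists_restrictTest_add_nonneg [FiniteDimensional ℝ E] (f : C_c(U, ℝ)) :
    ∃ φ : 𝓓(U, ℝ), ∀ x, 0 ≤ restrictTest φ x + f x := by
  obtain ⟨C, hC⟩ := f.continuous.bounded_above_of_compact_support f.hasCompactSupport
  obtain ⟨φ, hφ_nonneg, hφ_ge⟩ := exists_testFunction_ge (U := U)
    (f.hasCompactSupport.isCompact.image continuous_subtype_val)
    (by rintro _ ⟨x, -, rfl⟩; exact x.2) C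
  refine ⟨φ, fun x => ?_⟩
  change 0 ≤ φ x + f x
  by_cases hx : x ∈ tsupport f
  · exact neg_le_iff_add_nonneg'.1 <|
      (neg_le_neg (hφ_ge x ⟨x, hx, rfl⟩)).trans (neg_le_of_abs_le (hC x))
  · rw [image_eq_zero_of_notMem_tsupport hx, add_zero]
    exact hφ_nonneg x

variable [FiniteDimensional ℝ E]

lemma exists_positive_extension (Λ : 𝓓(U, ℝ) →ₗ[ℝ] ℝ)
    (hΛ : ∀ φ : 𝓓(U, ℝ), (∀ x, 0 ≤ φ x) → 0 ≤ Λ φ) :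
    ∃ g : C_c(U, ℝ) →ₚ[ℝ] ℝ, ∀ φ, g (restrictTest φ) = Λ φ := by
  let e := LinearEquiv.ofInjective (restrictTest (U := U)) restrictTest_injective
  let nonneg : PointedCone ℝ C_c(U, ℝ) :=
    { carrier := {f | ∀ x, 0 ≤ f x}
      add_mem' := fun hf hg x => add_nonneg (hf x) (hg x)
      zero_mem' := fun _ => le_rfl
      smul_mem' := fun c f hf x => mul_nonneg c.2 (hf x) }
  let f : C_c(U, ℝ) →ₗ.[ℝ] ℝ := ⟨LinearMap.range restrictTest, Λ ∘ₗ e.symm.toLinearMap⟩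
  have hf (φ : 𝓓(U, ℝ)) : f ⟨restrictTest φ, ⟨φ, rfl⟩⟩ = Λ φ :=
    congrArg Λ (e.symm_apply_apply φ)
  obtain ⟨g, hg, hg_nonneg⟩ := riesz_extension nonneg f
    (by
      rintro ⟨_, φ, rfl⟩ hφ
      rw [hf]
      exact hΛ φ (nonneg_of_restrictTest_nonneg hφ))
    (fun y => by
      obtain ⟨φ, hφ⟩ := exists_restrictTest_add_nonneg y
      exact ⟨⟨restrictTest φ, ⟨φ, rfl⟩⟩, hφ⟩)
  exact ⟨PositiveLinearMap.mk₀ g fun y hy => hg_nonneg y hy,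
    fun φ => (hg ⟨restrictTest φ, ⟨φ, rfl⟩⟩).trans (hf φ)⟩

theorem exists_measure_of_positive [MeasurableSpace E] [BorelSpace E] (Λ : 𝓓(U, ℝ) →ₗ[ℝ] ℝ)
    (hΛ : ∀ φ : 𝓓(U, ℝ), (∀ x, 0 ≤ φ x) → 0 ≤ Λ φ) :
    ∃ μ : Measure E, SigmaFinite μ ∧ (∀ K : Set E, IsCompact K → K ⊆ U → μ K < ⊤) ∧
      ∀ φ : 𝓓(U, ℝ), Λ φ = ∫ x, φ x ∂μ := by
  obtain ⟨g, hg⟩ := exists_positive_extension Λ hΛ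
  have hme : MeasurableEmbedding (Subtype.val : U → E) :=
    MeasurableEmbedding.subtype_coe U.isOpen.measurableSet
  have : LocallyCompactSpace U := U.isOpen.locallyCompactSpace
  refine ⟨(RealRMK.rieszMeasure g).map Subtype.val, hme.sigmaFinite_map,
    fun K hK hKU => ?_, fun φ => ?_⟩
  · rw [hme.map_apply]
    have h : IsCompact ((Subtype.val : U → E) ⁻¹' K) :=
      Topology.IsEmbedding.subtypeVal.isInducing.isCompact_preimage' hK
        (Subtype.range_coe.symm ▸ hKU)
    exact h.measure_lt_top
  · rw [hme.integral_map, ← hg, ← RealRMK.integral_rieszMeasure]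
    rfl

end TestFunction

/-! ### Measure functionals -/

lemma locallyIntegrableOn_rnDeriv_smul {X F : Type*} [TopologicalSpace X] [LocallyCompactSpace X]
    [T2Space X] [MeasurableSpace X] [OpensMeasurableSpace X] [NormedAddCommGroup F]
    [NormedSpace ℝ F] {μ ν : Measure X} [SigmaFinite μ] [SigmaFinite ν] (hμν : μ ≪ ν) {s : Set X}
    (hs : IsLocallyClosed s) {h : X → F} (hh : LocallyIntegrableOn h s μ) :
    LocallyIntegrableOn (fun x => (μ.rnDeriv ν x).toReal • h x) s ν := by
  rw [locallyIntegrableOn_iff hs] at hh ⊢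
  intro K hKs hK
  have hint := (integrable_rnDeriv_smul_iff hμν).2
    ((integrable_indicator_iff hK.measurableSet).2 (hh K hKs hK))
  rw [← integrable_indicator_iff hK.measurableSet]
  refine hint.congr (Eventually.of_forall fun x => ?_)
  by_cases hx : x ∈ K <;> simp [hx]

section MeasureFunctional

variable {E : Type*} [NormedAddCommGroup E] [NormedSpace ℝ E] {U : TopologicalSpace.Opens E}

/-- A real test function as a complex one. -/
def ofRealTest : 𝓓(U, ℝ) →L[ℝ] 𝓓(U, ℂ) := TestFunction.postcompCLM Complex.ofRealCLM

/-- The real part of a complex test function. -/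
def reTest : 𝓓(U, ℂ) →L[ℝ] 𝓓(U, ℝ) := TestFunction.postcompCLM Complex.reCLM

/-- The imaginary part of a complex test function. -/
def imTest : 𝓓(U, ℂ) →L[ℝ] 𝓓(U, ℝ) := TestFunction.postcompCLM Complex.imCLM

lemma ofRealTest_reTest_add (φ : 𝓓(U, ℂ)) :
    ofRealTest (reTest φ) + Complex.I • ofRealTest (imTest φ) = φ := by
  ext1 x
  change ((φ x).re : ℂ) + Complex.I * ((φ x).im : ℂ) = φ x
  rw [mul_comm, Complex.re_add_im]

lemma ofRealTest_smul (c : ℝ) (φ : 𝓓(U, ℝ)) : ofRealTest (c • φ) = (c : ℂ) • ofRealTest φ := by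
  ext1 x
  exact Complex.ofReal_mul c (φ x)

lemma im_apply_ofRealTest [FiniteDimensional ℝ E] {Λ : 𝓓(U, ℂ) →ₗ[ℂ] ℂ}
    (hΛ : ∀ φ : 𝓓(U, ℝ), (∀ x, 0 ≤ φ x) → (Λ (ofRealTest φ)).im = 0) (φ : 𝓓(U, ℝ)) :
    (Λ (ofRealTest φ)).im = 0 := by
  obtain ⟨C, hC⟩ := φ.continuous.bounded_above_of_compact_support φ.hasCompactSupport
  obtain ⟨χ, hχ_nonneg, hχ_ge⟩ :=
    exists_testFunction_ge φ.hasCompactSupport.isCompact φ.tsupport_subset C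
  have hsum := hΛ (φ + χ) fun x => by
    change 0 ≤ φ x + χ x
    by_cases hx : x ∈ tsupport φ
    · exact neg_le_iff_add_nonneg.1 <|
        (neg_le_neg (hχ_ge x hx)).trans (neg_le_of_abs_le (hC x))
    · rw [image_eq_zero_of_notMem_tsupport hx, zero_add]
      exact hχ_nonneg x
  rwa [map_add, map_add, Complex.add_im, hΛ χ hχ_nonneg, add_zero] at hsum

variable [MeasurableSpace E]

/-- A functional on test functions that is the integration against a complex Radon measure, given
as `h μ` with a σ-finite measure `μ` and a density `h` that is locally integrable on `U`. -/
def IsMeasureFunctional (Λ : 𝓓(U, ℂ) → ℂ) : Prop :=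
  ∃ (μ : Measure E) (h : E → ℂ), SigmaFinite μ ∧
    LocallyIntegrableOn h (U : Set E) μ ∧ ∀ φ : 𝓓(U, ℂ), Λ φ = ∫ x, φ x * h x ∂μ

lemma IsMeasureFunctional.const_mul {Λ : 𝓓(U, ℂ) → ℂ} (hΛ : IsMeasureFunctional Λ) (c : ℂ) :
    IsMeasureFunctional fun φ => c * Λ φ := by
  obtain ⟨μ, h, hσ, hh, hΛ⟩ := hΛ
  refine ⟨μ, fun x => c * h x, hσ, hh.smul c, fun φ => ?_⟩
  simp only [hΛ, ← integral_const_mul, mul_left_comm]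

lemma integrable_test_mul [OpensMeasurableSpace E] {μ : Measure E} {h : E → ℂ}
    (hh : LocallyIntegrableOn h (U : Set E) μ) (φ : 𝓓(U, ℂ)) : Integrable (fun x => φ x * h x) μ :=
  φ.integrable_bilin (ContinuousLinearMap.mul ℂ ℂ) hh

variable [FiniteDimensional ℝ E]

lemma IsMeasureFunctional.add [OpensMeasurableSpace E] {Λ₁ Λ₂ : 𝓓(U, ℂ) → ℂ}
    (hΛ₁ : IsMeasureFunctional Λ₁) (hΛ₂ : IsMeasureFunctional Λ₂) :
    IsMeasureFunctional fun φ => Λ₁ φ + Λ₂ φ := by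
  obtain ⟨μ₁, h₁, _, hh₁, hΛ₁⟩ := hΛ₁
  obtain ⟨μ₂, h₂, _, hh₂, hΛ₂⟩ := hΛ₂
  have hμ₁ : μ₁ ≪ μ₁ + μ₂ := Measure.AbsolutelyContinuous.rfl.add_right _
  have hμ₂ : μ₂ ≪ μ₁ + μ₂ := add_comm μ₁ μ₂ ▸ Measure.AbsolutelyContinuous.rfl.add_right _
  have hg₁ := locallyIntegrableOn_rnDeriv_smul hμ₁ U.isOpen.isLocallyClosed hh₁
  have hg₂ := locallyIntegrableOn_rnDeriv_smul hμ₂ U.isOpen.isLocallyClosed hh₂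
  refine ⟨μ₁ + μ₂, _, inferInstance, hg₁.add hg₂, fun φ => ?_⟩
  simp only [hΛ₁, hΛ₂, ← integral_rnDeriv_smul hμ₁, ← integral_rnDeriv_smul hμ₂, ← mul_smul_comm,
    Pi.add_apply, mul_add]
  exact (integral_add (integrable_test_mul hg₁ φ) (integrable_test_mul hg₂ φ)).symm

theorem isMeasureFunctional_of_nonneg [BorelSpace E] (Λ : 𝓓(U, ℂ) →ₗ[ℂ] ℂ)
    (hΛ : ∀ φ : 𝓓(U, ℝ), (∀ x, 0 ≤ φ x) → 0 ≤ (Λ (ofRealTest φ)).re ∧ (Λ (ofRealTest φ)).im = 0) :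
    IsMeasureFunctional Λ := by
  let Λre : 𝓓(U, ℝ) →ₗ[ℝ] ℝ :=
    { toFun := fun φ => (Λ (ofRealTest φ)).re
      map_add' := fun φ ψ => by rw [map_add, map_add, Complex.add_re]
      map_smul' := fun c φ => by
        rw [ofRealTest_smul, map_smul, smul_eq_mul, Complex.re_ofReal_mul]
        rfl }
  obtain ⟨μ, hσ, hfin, hμ⟩ := exists_measure_of_positive Λre fun φ hφ => (hΛ φ hφ).1
  have hreal (φ : 𝓓(U, ℝ)) : Λ (ofRealTest φ) = ((∫ x, φ x ∂μ : ℝ) : ℂ) := by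
    rw [← hμ]
    exact Complex.ext rfl (im_apply_ofRealTest (fun ψ hψ => (hΛ ψ hψ).2) φ)
  have hloc : LocallyIntegrableOn (fun _ : E => (1 : ℂ)) (U : Set E) μ := by
    rw [locallyIntegrableOn_iff U.isOpen.isLocallyClosed]
    exact fun K hKU hK => integrableOn_const (hfin K hK hKU).ne
  refine ⟨μ, fun _ => 1, hσ, hloc, fun φ => ?_⟩
  have hint := integrable_test_mul hloc φ
  calc Λ φ = Λ (ofRealTest (reTest φ)) + Complex.I * Λ (ofRealTest (imTest φ)) := by
        rw [← smul_eq_mul, ← map_smul, ← map_add, ofRealTest_reTest_add]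
    _ = ((∫ x, (φ x).re ∂μ : ℝ) : ℂ) + ((∫ x, (φ x).im ∂μ : ℝ) : ℂ) * Complex.I := by
        rw [hreal, hreal, mul_comm]
        rfl
    _ = ∫ x, φ x * 1 ∂μ := by
        rw [← integral_re_add_im hint]
        simp only [mul_one]
        rfl

end MeasureFunctional

/-! ### Functionals on test forms -/

section FormFunctional

variable {q : ℕ} {T S : TestForm Ω q →L[ℂ] ℂ} {u : Hn n → ℝ}

/-- The test form `φ ξ`, for a test function `φ` and a constant form `ξ`. -/
def constForm (ξ : Ext n q) : 𝓓(Ω, ℂ) →L[ℂ] TestForm Ω q :=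
  TestFunction.postcompCLM (ContinuousLinearMap.toSpanSingleton ℂ ξ)

lemma constForm_add (ξ₁ ξ₂ : Ext n q) (φ : 𝓓(Ω, ℂ)) :
    constForm (ξ₁ + ξ₂) φ = constForm ξ₁ φ + constForm ξ₂ φ := by
  ext1 x
  exact smul_add (φ x) ξ₁ ξ₂

lemma constForm_smul (c : ℂ) (ξ : Ext n q) (φ : 𝓓(Ω, ℂ)) :
    constForm (c • ξ) φ = c • constForm ξ φ := by
  ext1 x
  exact smul_comm (φ x) c ξ

/-- The coefficient `φ_J` of a test form `φ = ∑_J φ_J ω^J`. -/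
def testCoeff (J : MultiIndex n q) : TestForm Ω q →L[ℂ] 𝓓(Ω, ℂ) :=
  TestFunction.postcompCLM (ContinuousLinearMap.proj (R := ℂ) J)

lemma sum_constForm_testCoeff (φ : TestForm Ω q) :
    ∑ J, constForm (Pi.single J 1) (testCoeff J φ) = φ := by
  ext1 x
  rw [sum_apply]
  change ∑ J, φ x J • (Pi.single J 1 : Ext n q) = φ x
  exact (pi_eq_sum_univ' (φ x)).symm

/-- A functional on test forms that is real and nonnegative on strongly positive test forms. -/
def IsPositiveFunctional (T : TestForm Ω q →L[ℂ] ℂ) : Prop :=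
  ∀ η : TestForm Ω q, (∀ x ∈ Ω, IsStronglyPositive (η x)) → 0 ≤ (T η).re ∧ (T η).im = 0

/-- `T φ = ∑_J ∫ φ_J h_J dμ_J` with `h_J` locally integrable on `Ω`; this is
`Current.IsRepresentedBy` for test forms of an arbitrary degree. -/
def IsRepresentedBy (T : TestForm Ω q →L[ℂ] ℂ) (μ : MultiIndex n q → Measure (Hn n))
    (h : MultiIndex n q → Hn n → ℂ) : Prop :=
  (∀ J, LocallyIntegrableOn (h J) (Ω : Set (Hn n)) (μ J)) ∧
    ∀ φ : TestForm Ω q, T φ = ∑ J, ∫ x, φ x J * h J x ∂(μ J)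

/-- `S = uT`, where `T` has measure coefficients; this is `Current.IsProduct` for test forms of an
arbitrary degree. -/
def IsFunctionalProduct (u : Hn n → ℝ) (T S : TestForm Ω q →L[ℂ] ℂ) : Prop :=
  ∃ (μ : MultiIndex n q → Measure (Hn n)) (h : MultiIndex n q → Hn n → ℂ),
    IsRepresentedBy T μ h ∧ IsRepresentedBy S μ fun J x => (u x : ℂ) * h J x

lemma IsPositiveFunctional.isMeasureFunctional (hT : IsPositiveFunctional T) {ξ : Ext n q}
    (hξ : IsStronglyPositive ξ) : IsMeasureFunctional fun φ => T (constForm ξ φ) :=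
  isMeasureFunctional_of_nonneg (T ∘L constForm ξ).toLinearMap
    fun _ hφ => hT _ fun x _ => hξ.smul (hφ x)

/-- The strongly positive elements span all forms of even degree, so every coefficient of `T` is a
linear combination of positive measures. -/
theorem IsPositiveFunctional.exists_isRepresentedBy (hq : Even q) (hT : IsPositiveFunctional T) :
    ∃ μ h, IsRepresentedBy T μ h := by
  obtain ⟨r, rfl⟩ := even_iff_exists_two_mul.1 hq
  have hmeasure (ξ : Ext n (2 * r)) : IsMeasureFunctional fun φ => T (constForm ξ φ) := by
    have hξ : ξ ∈ stronglyPositiveSpan n (2 * r) := stronglyPositiveSpan_even (n := n) r ▸ trivial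
    induction hξ using Submodule.span_induction with
    | mem ξ hξ => exact hT.isMeasureFunctional hξ
    | zero => exact hT.isMeasureFunctional isStronglyPositive_zero
    | add ξ₁ ξ₂ _ _ h₁ h₂ => simpa only [constForm_add, map_add] using h₁.add h₂
    | smul c ξ _ h => simpa only [constForm_smul, map_smul, smul_eq_mul] using h.const_mul c
  choose μ h _ hloc hrep using fun J : MultiIndex n (2 * r) => hmeasure (Pi.single J 1)
  refine ⟨μ, h, hloc, fun φ => ?_⟩
  rw [← congrArg T (sum_constForm_testCoeff φ), map_sum]
  exact Finset.sum_congr rfl fun J _ => hrep J _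

lemma IsFunctionalProduct.tendsto (hS : IsFunctionalProduct u T S) (φ : TestForm Ω q)
    {v : ℕ → Hn n → ℝ} {M : ℝ} (hv : ∀ i, ContDiff ℝ ∞ (v i)) (hM : ∀ i x, |v i x| ≤ M)
    (hlim : ∀ x ∈ tsupport φ, Tendsto (fun i => v i x) atTop (nhds (u x))) :
    Tendsto (fun i => T (smulForm (v i) (hv i) φ)) atTop (nhds (S φ)) := by
  obtain ⟨μ, h, ⟨hloc, hT⟩, -, hS⟩ := hS
  simp only [hT, hS]
  refine tendsto_finsetSum _ fun J _ => ?_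
  have hint := integrable_test_mul (hloc J) (testCoeff J φ)
  have hint_smul (i : ℕ) := integrable_test_mul (hloc J) (testCoeff J (smulForm (v i) (hv i) φ))
  refine tendsto_integral_of_dominated_convergence (fun x => M * ‖φ x J * h J x‖)
    (fun i => (hint_smul i).aestronglyMeasurable) (hint.norm.const_mul M)
    (fun i => Eventually.of_forall fun x => ?_) (Eventually.of_forall fun x => ?_)
  · rw [smulForm_apply, Pi.smul_apply, smul_eq_mul, mul_assoc, norm_mul, Complex.norm_real]
    exact mul_le_mul_of_nonneg_right (hM i x) (norm_nonneg _)
  · simp only [smulForm_apply, Pi.smul_apply, smul_eq_mul, mul_assoc, mul_left_comm (φ x J)]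
    by_cases hx : x ∈ tsupport φ
    · exact ((Complex.continuous_ofReal.tendsto _).comp (hlim x hx)).mul_const _
    · simp only [image_eq_zero_of_notMem_tsupport hx, Pi.zero_apply, zero_mul, mul_zero,
        tendsto_const_nhds]

end FormFunctional

/-! ### Products with locally bounded plurisubharmonic functions -/

section Product

variable {q : ℕ} {T S : TestForm Ω q →L[ℂ] ℂ} {u : Hn n → EReal}

lemma locallyIntegrableOn_toReal_mul (hu : UpperSemicontinuousOn u (Ω : Set (Hn n)))
    (hlb : IsLocallyBounded Ω u) {μ : Measure (Hn n)} {h : Hn n → ℂ}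
    (hh : LocallyIntegrableOn h (Ω : Set (Hn n)) μ) :
    LocallyIntegrableOn (fun x => ((u x).toReal : ℂ) * h x) (Ω : Set (Hn n)) μ := by
  rw [locallyIntegrableOn_iff Ω.isOpen.isLocallyClosed] at hh ⊢
  intro K hKΩ hK
  obtain ⟨M, -, hM⟩ := hlb.exists_bound hK hKΩ
  have hmeas := measurable_indicator_toReal (hu.mono hKΩ) hK.isClosed
  have hint := Integrable.bdd_mul (c := M) (hh K hKΩ hK)
    (f := fun x => ((K.indicator (fun x => (u x).toReal) x : ℝ) : ℂ))
    (Complex.measurable_ofReal.comp hmeas).aestronglyMeasurable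
    ((ae_restrict_iff' hK.measurableSet).2 (Eventually.of_forall fun x hx => by
      rw [Complex.norm_real, Set.indicator_of_mem hx]
      exact abs_toReal_le (hM x hx)))
  refine IntegrableOn.congr_fun hint (fun x hx => ?_) hK.measurableSet
  simp only [Set.indicator_of_mem hx]

lemma IsRepresentedBy.exists_isFunctionalProduct {μ : MultiIndex n q → Measure (Hn n)}
    {h : MultiIndex n q → Hn n → ℂ} (hT : IsRepresentedBy T μ h)
    (hu : UpperSemicontinuousOn u (Ω : Set (Hn n))) (hlb : IsLocallyBounded Ω u) :
    ∃ S, IsFunctionalProduct (fun x => (u x).toReal) T S := by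
  have hloc (J) := locallyIntegrableOn_toReal_mul hu hlb (hT.1 J)
  refine ⟨∑ J, TestFunction.integralAgainstBilinCLM (ContinuousLinearMap.mul ℂ ℂ) (μ J)
    (fun x => ((u x).toReal : ℂ) * h J x) ∘L testCoeff J, μ, h, hT, hloc, fun φ => ?_⟩
  rw [sum_apply]
  exact Finset.sum_congr rfl fun J _ => TestFunction.integralAgainstBilinCLM_eq_integral (hloc J)

/-- The smooth approximations of `u` determine `uT` as a limit, whatever the chosen measures. -/
theorem IsPositiveFunctional.existsUnique_isFunctionalProduct (hq : Even q)
    (hT : IsPositiveFunctional T) (hu : IsPSH Ω u) (hlb : IsLocallyBounded Ω u) :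
    ∃! S, IsFunctionalProduct (fun x => (u x).toReal) T S := by
  obtain ⟨μ, h, hrep⟩ := hT.exists_isRepresentedBy hq
  refine existsUnique_of_exists_of_unique (hrep.exists_isFunctionalProduct hu.1 hlb)
    fun S S' hS hS' => ?_
  ext1 φ
  obtain ⟨v, M, hv, hM, hlim, -⟩ :=
    hu.exists_smooth_approx hlb φ.hasCompactSupport.isCompact φ.tsupport_subset
  exact tendsto_nhds_unique (hS.tendsto φ hv hM hlim) (hS'.tendsto φ hv hM hlim)

lemma IsPositiveFunctional.apply_laplaceWedgeForm {m : ℕ} {T : TestForm Ω (m + 2) →L[ℂ] ℂ}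
    (hT : IsPositiveFunctional T) {v : Hn n → ℝ} (hv : ContDiff ℝ ∞ v) {η : TestForm Ω m}
    (hη : ∀ x ∈ Ω, IsStronglyPositive (η x))
    (hpos : ∀ x ∈ tsupport η, ∀ w,
      0 ≤ ∑ e, hessian v x (rightMul (quatBasis e) w) (rightMul (quatBasis e) w)) :
    0 ≤ (T (laplaceWedgeForm v hv η)).re ∧ (T (laplaceWedgeForm v hv η)).im = 0 := by
  refine hT _ fun x hx => ?_
  change IsStronglyPositive (hessWedge m (hessian v x) 0 1 (η x))
  by_cases hxη : x ∈ tsupport η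
  · exact (hη x hx).hessWedge (isSymm_hessian (hv.of_le ENat.LEInfty.out) x) (hpos x hxη)
  · rw [image_eq_zero_of_notMem_tsupport hxη, map_zero]
    exact isStronglyPositive_zero

theorem IsFunctionalProduct.laplace_nonneg {m q₁ q₂ : ℕ} (h₁ : q₁ = m + 1) (h₂ : q₂ = m + 2)
    {T S : TestForm Ω q₂ →L[ℂ] ℂ} (hS : IsFunctionalProduct (fun x => (u x).toReal) T S)
    (hT : IsPositiveFunctional T) (hTc : ∀ α (ψ : TestForm Ω q₁), T (dForm q₁ q₂ α ψ) = 0)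
    (hu : IsPSH Ω u) (hlb : IsLocallyBounded Ω u) {η : TestForm Ω m}
    (hη : ∀ x ∈ Ω, IsStronglyPositive (η x)) :
    0 ≤ (S (dForm q₁ q₂ 0 (dForm m q₁ 1 η))).re ∧ (S (dForm q₁ q₂ 0 (dForm m q₁ 1 η))).im = 0 := by
  subst h₁ h₂
  set φ := dForm (m + 1) (m + 2) 0 (dForm m (m + 1) 1 η)
  obtain ⟨v, M, hv, hM, hlim, hpos⟩ := hu.exists_smooth_approx hlb
    (η.hasCompactSupport.isCompact.union φ.hasCompactSupport.isCompact)
    (Set.union_subset η.tsupport_subset φ.tsupport_subset)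
  have htend := hS.tendsto φ hv hM fun x hx => hlim x (Or.inr hx)
  have hnonneg (i : ℕ) : 0 ≤ (T (smulForm (v i) (hv i) φ)).re ∧
      (T (smulForm (v i) (hv i) φ)).im = 0 := by
    rw [apply_smulForm_laplace T hTc (hv i) η]
    exact hT.apply_laplaceWedgeForm (hv i) hη fun x hx => hpos i x (Or.inl hx)
  have him : Tendsto (fun i => (T (smulForm (v i) (hv i) φ)).im) atTop (nhds (S φ).im) :=
    (Complex.continuous_im.tendsto _).comp htend
  simp only [(hnonneg _).2] at him
  exact ⟨ge_of_tendsto ((Complex.continuous_re.tendsto _).comp htend)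
    (Eventually.of_forall fun i => (hnonneg i).1), tendsto_nhds_unique him tendsto_const_nhds⟩

end Product

/-! ### Products of currents -/

lemma dForm_eq_zero {p p' : ℕ} (h : p' ≠ p + 1) (α : Fin 2) (φ : TestForm Ω p) :
    dForm p p' α φ = 0 := by
  ext x J
  simp [coe_dForm, dFun, leftWedge_eq_zero h]

namespace Current

variable {k p : ℕ} {u : Hn n → EReal}

lemma IsClosed.apply_dForm {T : Current Ω p} (hT : T.IsClosed) (α : Fin 2)
    (ψ : TestForm Ω (2 * n - (p + 1))) : T (dForm _ _ α ψ) = 0 :=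
  neg_eq_zero.1 (DFunLike.congr_fun (hT α) ψ)

lemma IsPositive.existsUnique_isProduct {T : Current Ω (2 * k)} (hT : T.IsPositive)
    (hu : IsPSH Ω u) (hlb : IsLocallyBounded Ω u) :
    ∃! S : Current Ω (2 * k), IsProduct (fun x => (u x).toReal) T S :=
  IsPositiveFunctional.existsUnique_isFunctionalProduct (Nat.mul_sub 2 n k ▸ even_two_mul _)
    hT hu hlb

lemma isProduct_mul {T : Current Ω p} {u : Hn n → ℝ} (h : ∃ S, IsProduct u T S) :
    IsProduct u T (mul u T) := by
  rw [mul, dif_pos h]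
  exact h.choose_spec

lemma isClosed_laplaceWedge (u : Hn n → EReal) (T : Current Ω p) : (laplaceWedge u T).IsClosed :=
  isClosed_laplace _

lemma isPositive_laplaceWedge {T : Current Ω (2 * k)} (hTc : T.IsClosed) (hT : T.IsPositive)
    (hu : IsPSH Ω u) (hlb : IsLocallyBounded Ω u) : (laplaceWedge u T).IsPositive := by
  intro η hη
  change 0 ≤ (mul _ T (dForm _ _ 0 (dForm _ _ 1 η))).re ∧
    (mul _ T (dForm _ _ 0 (dForm _ _ 1 η))).im = 0
  by_cases hdeg : 2 * k + 2 ≤ 2 * n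
  · exact IsFunctionalProduct.laplace_nonneg (by omega) (by omega)
      (isProduct_mul (hT.existsUnique_isProduct hu hlb).exists) hT hTc.apply_dForm hu hlb hη
  · rw [dForm_eq_zero (p := 2 * n - (2 * k + 2)) (by omega)]
    simp only [map_zero, Complex.zero_re, Complex.zero_im, le_refl, and_self]

lemma isClosed_and_isPositive_laplaceWedges {T : Current Ω (2 * k)} (hTc : T.IsClosed)
    (hT : T.IsPositive) (m : ℕ) (u : Fin m → Hn n → EReal) (hu : ∀ i, IsPSH Ω (u i))
    (hlb : ∀ i, IsLocallyBounded Ω (u i)) :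
    (laplaceWedges T m u).IsClosed ∧ (laplaceWedges T m u).IsPositive := by
  have hstep {p : ℕ} (hp : Even p) {F : Current Ω p} (hFc : F.IsClosed) (hF : F.IsPositive)
      {u : Hn n → EReal} (hu : IsPSH Ω u) (hlb : IsLocallyBounded Ω u) :
      (laplaceWedge u F).IsPositive := by
    obtain ⟨k, rfl⟩ := even_iff_exists_two_mul.1 hp
    exact isPositive_laplaceWedge hFc hF hu hlb
  induction m with
  | zero => exact ⟨hTc, hT⟩
  | succ m ih =>
    obtain ⟨hFc, hF⟩ := ih (Fin.tail u) (fun i => hu i.succ) (fun i => hlb i.succ)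
    exact ⟨isClosed_laplaceWedge _ _,
      hstep ((even_two_mul k).add (even_two_mul m)) hFc hF (hu 0) (hlb 0)⟩

end Current

end QuatPluripotential

end

open QuatPluripotential in
theorem proposition3p7 {n k : ℕ} (hk : k ≤ n) (Ω : TopologicalSpace.Opens (Hn n))
    (T : Current Ω (2 * k)) (hTclosed : T.IsClosed) (hTpos : T.IsPositive) :
    (∀ u : Hn n → EReal, IsPSH Ω u → IsLocallyBounded Ω u →
      (∃! S : Current Ω (2 * k), Current.IsProduct (fun x => (u x).toReal) T S) ∧
        (Current.laplaceWedge u T).IsClosed ∧ (Current.laplaceWedge u T).IsPositive) ∧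
    ∀ (p : ℕ) (u : Fin p → Hn n → EReal),
      (∀ i, IsPSH Ω (u i)) → (∀ i, IsLocallyBounded Ω (u i)) →
        (Current.laplaceWedges T p u).IsClosed ∧ (Current.laplaceWedges T p u).IsPositive :=
  ⟨fun _ hu hlb => ⟨hTpos.existsUnique_isProduct hu hlb, Current.isClosed_laplaceWedge _ _,
    Current.isPositive_laplaceWedge hTclosed hTpos hu hlb⟩,
    Current.isClosed_and_isPositive_laplaceWedges hTclosed hTpos⟩
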